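/- Let $K$ be an algebraically closed field of arbitrary characteristic. A reduced curve $C:\{f=0\}$ is the ideal of $K[[x,y]]$ generated by a nonzero power series $f$ without constant term and without multiple factors; a branch is a curve with irreducible equation, and the branches (irreducible components) of $C$ are the curves $C_i:\{f_i=0\}$ defined by the irreducible factors $f_i$ of $f$; their number is $r(C)$. Let $m(C)=\operatorname{ord} f$ be the multiplicity; a branch is smooth if its multiplicity is $1$, and $C$ is singular if $m(C)>1$. Put $(C,D)_0=\dim_K K[[x,y]]/(f,g)\in\mathbb N\cup\{\infty\}$ for $C:\{f=0\}$, $D:\{g=0\}$. For branches $C,D$ let $d(C,D)=\frac{(C,D)_0}{m(C)m(D)}$; for reduced curves with branches $C_i$ and $D_j$ let $d(C,D)=\inf_{i,j} d(C_i,D_j)$. The contact exponent of $C$ is $d(C)=\sup\{d(C,W): W \text{ a smooth branch}\}$. Let $\mathcal O_C=K[[x,y]]/(f)$, let $\overline{\mathcal O}_C$ be its integral closure in its total ring of fractions, $\mathcal C=\{a\in\overline{\mathcal O}_C: a\overline{\mathcal O}_C\subseteq\mathcal O_C\}$ the conductor, and $c(C)=\dim_K\overline{\mathcal O}_C/\mathcal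 C$. The Milnor number of $C$ is $\mu(C)=c(C)-r(C)+1$. The semigroup of a branch $C:\{f=0\}$ is $\Gamma(C)=\{(f,g)_0 : g\in K[[x,y]],\ f\nmid g\}$. Two reduced curves $C:\{f=0\}$ and $D:\{g=0\}$ are equisingular if there are factorizations $f=f_1\cdots f_r$ and $g=g_1\cdots g_r$ into the same number of irreducible factors such that the branches $C_i:\{f_i=0\}$ and $D_i:\{g_i=0\}$ satisfy $\Gamma(C_i)=\Gamma(D_i)$ for all $i$ and $(C_i,C_j)_0=(D_i,D_j)_0$ for all $i,j$. Theorem. Let $C_1,C_2$ be two reduced singular curves over $K$ such that $\mu(C_i)=(d(C_i)m(C_i)-1)(m(C_i)-1)$ for $i\in\{1,2\}$. Then $C_1$ and $C_2$ are equisingular if and only if $(m(C_1),d(C_1))=(m(C_2),d(C_2))$. -/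

import Mathlib

open scoped ENNReal

noncomputable section

namespace PlaneCurve

/-- The ring `K[[x,y]]` of formal power series in two variables. -/
abbrev Series (K : Type*) [Field K] : Type _ := MvPowerSeries (Fin 2) K

variable {K : Type*} [Field K]

/-- `f` is the equation of a reduced algebroid curve: a nonzero power series without constant term
and without multiple factors. The curve `C : {f = 0}` is the ideal generated by `f`; it is
represented here by an equation `f`. -/
def IsReducedCurve (f : Series K) : Prop :=
  f ≠ 0 ∧ MvPowerSeries.constantCoeff f = 0 ∧ Squarefree f

/-- The multiplicity `m(C)`, i.e. the order of the equation `f` (used for `f ≠ 0` only). -/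
def mult (f : Series K) : ℕ := (MvPowerSeries.order f).toNat

/-- The curve is singular, i.e. not smooth: its multiplicity is greater than `1`. -/
def IsSingular (f : Series K) : Prop := 1 < mult f

/-- `p` is the equation of an irreducible component (branch) of the curve `{f = 0}`. -/
def IsBranchOf (p f : Series K) : Prop := Irreducible p ∧ p ∣ f

/-- `w` is the equation of a smooth branch. -/
def IsSmoothBranch (w : Series K) : Prop := Irreducible w ∧ mult w = 1

/-- The intersection number `(f,g)₀ = dim_K K[[x,y]]/(f,g)`, possibly infinite. -/
def intersectionNumber (f g : Series K) : ℕ∞ :=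
  Cardinal.toENat (Module.rank K (Series K ⧸ Ideal.span ({f, g} : Set (Series K))))

/-- The semigroup `Γ(f) = {(f,g)₀ : g ≢ 0 mod f}` of a branch `{f = 0}`. -/
def semigroup (f : Series K) : Set ℕ :=
  {n | ∃ g : Series K, ¬ f ∣ g ∧ intersectionNumber f g = n}

/-- Equisingularity of reduced curves: there are factorizations `f = f₁⋯f_r`, `g = g₁⋯g_r` into
the same number of irreducible factors, such that corresponding branches have the same semigroup
and corresponding pairs of branches have the same intersection number. -/
def Equisingular (f g : Series K) : Prop :=
  ∃ (r : ℕ) (p q : Fin r → Series K),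
    (∀ i, Irreducible (p i)) ∧ (∀ i, Irreducible (q i)) ∧
    f = ∏ i, p i ∧ g = ∏ i, q i ∧
    (∀ i, semigroup (p i) = semigroup (q i)) ∧
    (∀ i j, intersectionNumber (p i) (p j) = intersectionNumber (q i) (q j))

/-- The order of contact `d(C,D) = (C,D)₀ / (m(C) m(D))` of two branches. -/
def branchContact (p q : Series K) : ℝ≥0∞ :=
  (intersectionNumber p q : ℝ≥0∞) / ((mult p : ℝ≥0∞) * (mult q : ℝ≥0∞))

/-- `d(C,D)` for reduced curves: the infimum of `d(Cᵢ,Dⱼ)` over all components `Cᵢ` of `C`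
and `Dⱼ` of `D`. -/
def contact (f g : Series K) : ℝ≥0∞ :=
  ⨅ (p : Series K) (_ : IsBranchOf p f) (q : Series K) (_ : IsBranchOf q g), branchContact p q

/-- The contact exponent `d(C)`: the supremum of `d(C,W)` over all smooth branches `W`. -/
def contactExponent (f : Series K) : ℝ≥0∞ :=
  ⨆ (w : Series K) (_ : IsSmoothBranch w), contact f w

/-- The number `r(C)` of branches, counted as ideals. -/
def numBranches (f : Series K) : ℕ :=
  Set.ncard {P : Ideal (Series K) | ∃ p, IsBranchOf p f ∧ P = Ideal.span {p}}

/-- The local ring `O_C = K[[x,y]]/(f)`. -/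
abbrev LocalRing (f : Series K) : Type _ := Series K ⧸ Ideal.span ({f} : Set (Series K))

/-- The integral closure of `O_C` in its total ring of fractions. -/
abbrev Normalization (f : Series K) :
    Subalgebra (LocalRing f) (FractionRing (LocalRing f)) :=
  integralClosure (LocalRing f) (FractionRing (LocalRing f))

/-- The conductor `{a : a Ō_C ⊆ O_C}` of the integral closure `Ō_C` in `O_C`,
as an ideal of `Ō_C`. -/
def conductor (f : Series K) : Ideal (Normalization f) where
  carrier := {a | ∀ b : Normalization f, ∃ c : LocalRing f,
    algebraMap (LocalRing f) (Normalization f) c = a * b}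
  zero_mem' := fun b => ⟨0, by rw [map_zero, zero_mul]⟩
  add_mem' := by
    intro a a' ha ha' b
    obtain ⟨c, hc⟩ := ha b
    obtain ⟨c', hc'⟩ := ha' b
    exact ⟨c + c', by rw [map_add, hc, hc', add_mul]⟩
  smul_mem' := by
    intro s a ha b
    obtain ⟨c, hc⟩ := ha (s * b)
    exact ⟨c, by rw [hc, smul_eq_mul]; ring⟩

/-- The degree of the conductor `c(C) = dim_K Ō_C / conductor`. -/
def conductorDegree (f : Series K) : ℕ∞ :=
  Cardinal.toENat (Module.rank K (Normalization f ⧸ conductor f))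

/-- The Milnor number `μ(C) = c(C) - r(C) + 1`. -/
def milnorNumber (f : Series K) : EReal :=
  (((conductorDegree f : ℕ∞) : ℝ≥0∞) : EReal) - (numBranches f : EReal) + 1

/-- The curve attains the bound: `μ(C) = (d(C) m(C) - 1)(m(C) - 1)`, an equality of extended
real numbers. -/
def AttainsMilnorBound (f : Series K) : Prop :=
  milnorNumber f =
    ((contactExponent f : EReal) * (mult f : EReal) - 1) * ((mult f : EReal) - 1)

end PlaneCurve

end

set_option linter.unusedSectionVars false

/-! Attaining the bound means that a sum of local inequalities is an equality, and equality pins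
down every local invariant. Let D be the contact exponent, mᵢ and cᵢ the multiplicities and
conductor exponents of the r branches Cᵢ, and M = ∑ mᵢ. The conductor of the curve has degree ∑ cᵢ +
∑_{i≠j} (Cᵢ,Cⱼ)₀ (`conductorDegree_eq`). Some smooth branch w satisfies (Cᵢ,w)₀ ≥ D mᵢ for all i
(`exists_smooth_of_contactExponent`). It forces cᵢ ≥ (mᵢ-1)(D mᵢ-1) (`le_conductorExponent`) and,
through a strong triangle inequality (`min_le_intersectionNumber`), (Cᵢ,Cⱼ)₀ ≥ D mᵢ mⱼ. These bounds
add up to (DM-1)(M-1) + r - 1, so all of them are equalities (`structure_of_attainsMilnorBound`).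

Equality on a branch with mᵢ ≥ 2 makes D mᵢ an integer prime to mᵢ and Γ(Cᵢ) = ⟨mᵢ, D mᵢ⟩
(`hasSemigroupOfSlope`). So every mᵢ ≥ 2 is the reduced denominator of D, and elementary arithmetic
recovers the family (mᵢ) from D and M (`IsSlopeFamily.exists_equiv`); the pair (M, D) then
determines all semigroups and intersection numbers. Conversely the semigroups give the mᵢ, and D is
read off an intersection number of two branches, or off the semigroup when there is only one branch.

The characteristic-free tool behind this is a parametrization K[[x,y]]/(p) → K[[t]] of each branch
whose image contains all multiples of some power of t (`exists_parametrization`). It comes from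
Weierstrass preparation and the normalization of a finite extension of K[[X]]. Intersection numbers
with p become orders in t (`intersectionNumber_eq_order`). -/

noncomputable section

namespace PlaneCurve

open PowerSeries

/-! ### Expansion of ring elements in powers of a uniformizer. -/

section Digits

variable {k O : Type*} [Field k] [CommRing O] [IsDomain O] [Algebra k O]

/-- Removing the residue of `z` and dividing by the uniformizer `t`. -/
def digitShift (t : O) (c : O →ₐ[k] k) (h : ∀ z, t ∣ z - algebraMap k O (c z)) (z : O) : O :=
  (h z).choose

variable {t : O} {c : O →ₐ[k] k} (h : ∀ z, t ∣ z - algebraMap k O (c z))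

theorem eq_add_mul_digitShift (z : O) :
    z = algebraMap k O (c z) + t * digitShift t c h z := by
  rw [digitShift, ← (h z).choose_spec]; ring

/-- The expansion of `z` in powers of `t`. -/
def digits (z : O) : k⟦X⟧ := PowerSeries.mk fun n => c ((digitShift t c h)^[n] z)

theorem coeff_zero_digits (z : O) : coeff 0 (digits h z) = c z := by simp [digits]

theorem coeff_succ_digits (z : O) (n : ℕ) :
    coeff (n + 1) (digits h z) = coeff n (digits h (digitShift t c h z)) := by
  simp [digits]

theorem digits_eq (z : O) :
    digits h z = PowerSeries.C (c z) + X * digits h (digitShift t c h z) := by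
  ext n
  cases n with
  | zero => rw [coeff_zero_digits, map_add, coeff_zero_C, coeff_zero_X_mul, add_zero]
  | succ n => simp [coeff_succ_digits, coeff_succ_X_mul]

theorem digitShift_unique (ht : t ≠ 0) {z s : O}
    (hz : z = algebraMap k O (c z) + t * s) : digitShift t c h z = s := by
  have := eq_add_mul_digitShift h z
  refine mul_left_cancel₀ ht ?_
  rw [hz] at this
  have h2 := this.symm
  rw [← hz] at h2
  exact add_left_cancel (h2.trans hz)

theorem digitShift_add (ht : t ≠ 0) (z w : O) :
    digitShift t c h (z + w) = digitShift t c h z + digitShift t c h w := by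
  apply digitShift_unique h ht
  conv_lhs => rw [eq_add_mul_digitShift h z, eq_add_mul_digitShift h w]
  simp only [map_add]; ring

/-- A Leibniz rule twisted by the residue map; it is what makes `digits` multiplicative, coefficient
by coefficient. -/
theorem digitShift_mul (ht : t ≠ 0) (z w : O) :
    digitShift t c h (z * w) =
      digitShift t c h z * w + algebraMap k O (c z) * digitShift t c h w := by
  apply digitShift_unique h ht
  have hz := eq_add_mul_digitShift h z
  have hw := eq_add_mul_digitShift h w
  simp only [map_mul]
  linear_combination w * hz + algebraMap k O (c z) * hw

theorem digitShift_algebraMap (ht : t ≠ 0) (a : k) : digitShift t c h (algebraMap k O a) = 0 := by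
  apply digitShift_unique h ht
  simp

theorem digits_add (ht : t ≠ 0) (z w : O) : digits h (z + w) = digits h z + digits h w := by
  ext n
  induction n generalizing z w with
  | zero => simp only [map_add, coeff_zero_digits]
  | succ n ih => rw [map_add, coeff_succ_digits, coeff_succ_digits, coeff_succ_digits,
      digitShift_add h ht, ih, map_add]

theorem digits_algebraMap (ht : t ≠ 0) (a : k) :
    digits h (algebraMap k O a) = PowerSeries.C a := by
  have h0 : digits h (0 : O) = 0 := by
    have := digits_add h ht 0 0
    rw [add_zero] at this
    simpa using this
  rw [digits_eq, digitShift_algebraMap h ht, h0]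
  simp

theorem digits_mul (ht : t ≠ 0) (z w : O) : digits h (z * w) = digits h z * digits h w := by
  ext n
  induction n generalizing z w with
  | zero =>
    have e : ∀ f g : k⟦X⟧, coeff 0 (f * g) = coeff 0 f * coeff 0 g := fun f g => by simp
    rw [e, coeff_zero_digits, coeff_zero_digits, coeff_zero_digits, map_mul]
  | succ n ih =>
    rw [coeff_succ_digits, digitShift_mul h ht, digits_add h ht, map_add, ih, ih,
      digits_algebraMap h ht, digits_eq h z, add_mul, map_add, mul_assoc X, coeff_succ_X_mul,
      coeff_C_mul, coeff_C_mul, ← coeff_succ_digits]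
    ring

/-- The expansion in powers of `t` as a homomorphism to power series. -/
def digitsHom (ht : t ≠ 0) : O →ₐ[k] k⟦X⟧ where
  toFun := digits h
  map_one' := by rw [← map_one (algebraMap k O), digits_algebraMap h ht, map_one]
  map_zero' := by rw [← map_zero (algebraMap k O), digits_algebraMap h ht, map_zero]
  map_mul' := digits_mul h ht
  map_add' := digits_add h ht
  commutes' := digits_algebraMap h ht

/-- Reduces injectivity of the expansion to the Hausdorff property of the t-adic topology. -/
theorem pow_dvd_of_digits_eq_zero (z : O) (hz : digits h z = 0) (n : ℕ) : t ^ n ∣ z := by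
  induction n generalizing z with
  | zero => simp
  | succ n ih =>
    have h0 : c z = 0 := by rw [← coeff_zero_digits h, hz, map_zero]
    have h1 : digits h (digitShift t c h z) = 0 := by
      ext n; rw [← coeff_succ_digits, hz]; simp
    rw [eq_add_mul_digitShift h z, h0, map_zero, zero_add, pow_succ']
    exact mul_dvd_mul_left _ (ih _ h1)

theorem digitsHom_uniformizer (ht : t ≠ 0) (hc : c t = 0) : digitsHom h ht t = X := by
  change digits h t = X
  have h1 : digitShift t c h t = 1 := digitShift_unique h ht (by simp [hc])
  have h2 : digits h (1 : O) = 1 := (digitsHom h ht).map_one'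
  rw [digits_eq, h1, h2, hc]; simp

end Digits

/-! ### `K⟦X⟧` as a module over a subring generated by a parameter. -/

section Decomposition

variable {K : Type*} [Field K]

theorem exists_eq_X_pow_mul_isUnit {z : K⟦X⟧} {n : ℕ} (hz : z.order = n) :
    ∃ e : K⟦X⟧, IsUnit e ∧ z = X ^ n * e := by
  obtain ⟨e, he⟩ := X_pow_dvd_iff.mpr (fun m hm => coeff_of_lt_order m (by rw [hz]; exact_mod_cast hm))
  refine ⟨e, ?_, he⟩
  rw [isUnit_iff_constantCoeff, isUnit_iff_ne_zero, ← coeff_zero_eq_constantCoeff_apply]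
  have h1 : coeff n z ≠ 0 := by
    have := order_eq_nat.mp hz
    exact this.1
  rw [he] at h1
  have := coeff_X_pow_mul e n 0
  rw [zero_add] at this
  rwa [this] at h1

theorem X_pow_dvd_iff_le_order {z : K⟦X⟧} {n : ℕ} : X ^ n ∣ z ↔ (n : ℕ∞) ≤ z.order :=
  X_pow_dvd_iff.trans ⟨fun h => nat_le_order _ _ h,
    fun h m hm => coeff_of_lt_order m (lt_of_lt_of_le (by exact_mod_cast hm) h)⟩

theorem dvd_iff_order_le {z w : K⟦X⟧} : w ∣ z ↔ w.order ≤ z.order := by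
  constructor
  · rintro ⟨q, rfl⟩; rw [order_mul]; exact le_self_add
  · intro h
    rcases eq_or_ne w.order ⊤ with hw | hw
    · rw [hw, top_le_iff, order_eq_top] at h; simp [h]
    · obtain ⟨n, hn⟩ := ENat.ne_top_iff_exists.mp hw
      obtain ⟨e, he, rfl⟩ := exists_eq_X_pow_mul_isUnit hn.symm
      exact he.mul_right_dvd.mpr (X_pow_dvd_iff_le_order.mpr (hn ▸ h))

/-- Successive approximation by a family `E n` of series of order exactly `n`. -/
theorem exists_digits_of_order_eq (E : ℕ → K⟦X⟧) (hE : ∀ n, (E n).order = n) (z : K⟦X⟧) :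
    ∃ a : ℕ → K, (∀ n, X ^ n ∣ z - ∑ i ∈ Finset.range n, a i • E i) ∧
      ∀ n : ℕ, (n : ℕ∞) < z.order → a n = 0 := by
  have step : ∀ (n : ℕ) (w : K⟦X⟧), X ^ n ∣ w → X ^ (n + 1) ∣ w - (coeff n w / coeff n (E n)) • E n := by
    intro n w hw
    rw [X_pow_dvd_iff] at hw ⊢
    intro m hm
    have hE' := order_eq_nat.mp (hE n)
    rcases Nat.lt_succ_iff_lt_or_eq.mp hm with h | rfl
    · simp [hw m h, hE'.2 m h]
    · simp [hE'.1]
  let w : ℕ → K⟦X⟧ := fun n => Nat.rec z (fun n w => w - (coeff n w / coeff n (E n)) • E n) n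
  have w1 : ∀ n, w (n + 1) = w n - (coeff n (w n) / coeff n (E n)) • E n := fun n => rfl
  have hw : ∀ n, w n = z - ∑ i ∈ Finset.range n, (coeff i (w i) / coeff i (E i)) • E i := by
    intro n
    induction n with
    | zero => simp [w]
    | succ n ih => rw [w1, Finset.sum_range_succ, ← sub_sub, ← ih]
  have hd : ∀ n, X ^ n ∣ w n := by
    intro n
    induction n with
    | zero => simp
    | succ n ih => rw [w1]; exact step n _ ih
  refine ⟨fun i => coeff i (w i) / coeff i (E i), fun n => by rw [← hw]; exact hd n, ?_⟩
  have hz : ∀ n : ℕ, (n : ℕ∞) ≤ z.order → w n = z := by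
    intro n
    induction n with
    | zero => intro; rfl
    | succ n ih =>
      intro h
      have h' : (n : ℕ∞) < z.order := lt_of_lt_of_le (by exact_mod_cast n.lt_succ_self) h
      rw [w1, ih h'.le, coeff_of_lt_order n h']; simp
  intro n hn
  simp only
  rw [hz n hn.le, coeff_of_lt_order n hn, zero_div]

/-- Stands in for continuity of θ, which is only a homomorphism of algebras: the tail of `a` is a
multiple of a power of X, and θ respects that factorization. -/
theorem eq_sum_mul_pow_add {S : Type*} [CommRing S] [Algebra K S] (θ : K⟦X⟧ →ₐ[K] S) (a : K⟦X⟧)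
    (n : ℕ) : ∃ b, θ a = ∑ j ∈ Finset.range n, coeff j a • θ X ^ j + θ X ^ n * θ b := by
  obtain ⟨b, hb⟩ : (X : K⟦X⟧) ^ n ∣ a - ∑ j ∈ Finset.range n, coeff j a • X ^ j := by
    rw [X_pow_dvd_iff]
    intro m hm
    simp [coeff_X_pow, hm]
  refine ⟨b, ?_⟩
  rw [← map_pow, ← map_mul, ← hb, map_sub, map_sum]
  simp

theorem eq_zero_of_forall_X_pow_dvd {z : K⟦X⟧} (h : ∀ n : ℕ, X ^ n ∣ z) : z = 0 := by
  ext n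
  simpa using X_pow_dvd_iff.mp (h (n + 1)) n n.lt_succ_self

/-- `K⟦X⟧` is generated by `1, X, …, X ^ (m - 1)` over any parameter of order `m`. -/
theorem exists_decomposition (θ : K⟦X⟧ →ₐ[K] K⟦X⟧) {m : ℕ} (hm : 0 < m) (hθ : (θ X).order = m)
    (z : K⟦X⟧) : ∃ a : Fin m → K⟦X⟧, z = ∑ i, θ (a i) * X ^ (i : ℕ) ∧
      ∀ i, z.order ≤ m * (a i).order + (i : ℕ) := by
  have hE : ∀ n : ℕ, (θ X ^ (n / m) * X ^ (n % m) : K⟦X⟧).order = n := by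
    intro n
    rw [order_mul, order_pow, order_X_pow, hθ, nsmul_eq_mul]
    norm_cast
    rw [mul_comm]; exact Nat.div_add_mod n m
  obtain ⟨c, hc, hc0⟩ := exists_digits_of_order_eq _ hE z
  refine ⟨fun i => PowerSeries.mk fun j => c (m * j + i), ?_, ?_⟩
  · rw [← sub_eq_zero]
    apply eq_zero_of_forall_X_pow_dvd
    intro n
    have h1 := hc (m * n)
    have h2 : (X : K⟦X⟧) ^ (m * n) ∣ ∑ i ∈ Finset.range (m * n), c i • (θ X ^ (i / m) * X ^ (i % m))
        - ∑ i : Fin m, θ (PowerSeries.mk fun j => c (m * j + i)) * X ^ (i : ℕ) := by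
      have h3 : ∑ i ∈ Finset.range (m * n), c i • (θ X ^ (i / m) * X ^ (i % m) : K⟦X⟧) =
          ∑ i : Fin m, ∑ j ∈ Finset.range n, c (m * j + i) • (θ X ^ j * X ^ (i : ℕ)) := by
        rw [Finset.sum_comm, Finset.sum_range, Finset.sum_range, ← (finProdFinEquiv.trans
          (finCongr (mul_comm n m))).sum_comp, Fintype.sum_prod_type]
        refine Finset.sum_congr rfl fun j _ => Finset.sum_congr rfl fun i _ => ?_
        have e1 : ((i : ℕ) + m * j) / m = j := by
          rw [Nat.add_mul_div_left _ _ hm, Nat.div_eq_of_lt i.2, zero_add]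
        have e2 : ((i : ℕ) + m * j) % m = i := by
          rw [Nat.add_mul_mod_self_left, Nat.mod_eq_of_lt i.2]
        simp only [Equiv.trans_apply, finCongr_apply, Fin.val_cast, finProdFinEquiv_apply_val, e1, e2]
        rw [add_comm (i : ℕ)]
      rw [h3, ← Finset.sum_sub_distrib]
      refine Finset.dvd_sum fun i _ => ?_
      obtain ⟨b, hb⟩ := eq_sum_mul_pow_add θ (PowerSeries.mk fun j => c (m * j + i)) n
      rw [hb, add_mul, Finset.sum_mul]
      simp only [coeff_mk, smul_mul_assoc, sub_add_cancel_left]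
      rw [dvd_neg, mul_assoc]
      refine Dvd.dvd.mul_right ?_ _
      rw [X_pow_dvd_iff_le_order, order_pow, hθ, nsmul_eq_mul, mul_comm]
      push_cast; exact le_rfl
    have h4 := dvd_add h1 h2
    rw [sub_add_sub_cancel] at h4
    exact (pow_dvd_pow _ (Nat.le_mul_of_pos_left n hm)).trans h4
  · intro i
    rcases eq_or_ne (PowerSeries.mk fun j => c (m * j + i)).order ⊤ with h | h
    · simp only [h]
      rw [ENat.mul_top (by exact_mod_cast hm.ne')]; simp
    · obtain ⟨n, hn⟩ := ENat.ne_top_iff_exists.mp h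
      by_contra hlt
      rw [not_le, ← hn] at hlt
      have h5 := hc0 (m * n + i) (by push_cast; exact hlt)
      have h6 := (order_eq_nat.mp hn.symm).1
      simp [h5] at h6

end Decomposition

/-! ### Integral elements over `k⟦X⟧` via Weierstrass preparation. -/

section ValuationRing

variable {k : Type*} [Field k]

theorem isAdicComplete_maximalIdeal :
    IsAdicComplete (IsLocalRing.maximalIdeal k⟦X⟧) k⟦X⟧ := by
  rw [PowerSeries.maximalIdeal_eq_span_X]; infer_instance

theorem residue_eq_zero_iff {a : k⟦X⟧} : IsLocalRing.residue k⟦X⟧ a = 0 ↔ X ∣ a := by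
  rw [IsLocalRing.residue_eq_zero_iff, PowerSeries.maximalIdeal_eq_span_X,
    Ideal.mem_span_singleton]

/-- An irreducible polynomial over `k⟦X⟧` which is not constant either has invertible constant
term or is a unit multiple of a distinguished polynomial. -/
theorem constantCoeff_isUnit_or_exists_distinguished {H : Polynomial k⟦X⟧} (hH : Irreducible H)
    (hX : ¬ Polynomial.C X ∣ H) :
    IsUnit (H.coeff 0) ∨ ∃ f : Polynomial k⟦X⟧,
      f.IsDistinguishedAt (IsLocalRing.maximalIdeal k⟦X⟧) ∧ 0 < f.natDegree ∧ Associated H f := by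
  have := isAdicComplete_maximalIdeal (k := k)
  have hne : (H : k⟦X⟧⟦X⟧).map (IsLocalRing.residue k⟦X⟧) ≠ 0 := by
    intro h
    apply hX
    rw [Polynomial.C_dvd_iff_dvd_coeff]
    intro i
    rw [← residue_eq_zero_iff]
    simpa using congrArg (PowerSeries.coeff i) h
  obtain ⟨f, U, hf⟩ := exists_isWeierstrassFactorization hne
  have hfd := hf.isDistinguishedAt
  rcases Nat.eq_zero_or_pos f.natDegree with h0 | hpos
  · left
    have hf1 : f = 1 := hfd.monic.natDegree_eq_zero.mp h0
    have h1 := hf.eq_mul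
    rw [hf1, Polynomial.coe_one, one_mul] at h1
    have h2 := isUnit_iff_constantCoeff.mp hf.isUnit
    rw [← h1] at h2
    simpa using h2
  · right
    refine ⟨f, hfd, hpos, ?_⟩
    -- The factorization gives divisibility among power series only. Comparing it with polynomial
    -- division by the monic f, uniqueness of Weierstrass division forces the remainder to vanish.
    have hdvd : f ∣ H := by
      rw [← Polynomial.modByMonic_eq_zero_iff_dvd hfd.monic]
      have hdiv := Polynomial.modByMonic_add_div H f
      have e1 : ((f : k⟦X⟧⟦X⟧).map (Ideal.Quotient.mk (IsLocalRing.maximalIdeal k⟦X⟧))).order.toNat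
          = f.natDegree := by
        have := hfd.coe_natDegree_eq_order_map (f : k⟦X⟧⟦X⟧) 1 (by
          simp) (by simp)
        rw [← this]; simp
      have hdeg : (H %ₘ f).degree < ((f : k⟦X⟧⟦X⟧).map
          (Ideal.Quotient.mk (IsLocalRing.maximalIdeal k⟦X⟧))).order.toNat := by
        rw [e1, ← Polynomial.degree_eq_natDegree hfd.monic.ne_zero]
        exact Polynomial.degree_modByMonic_lt _ hfd.monic
      have h3 := hfd.isWeierstrassDivisorAt'.eq_of_mul_add_eq_mul_add
        (q := U) (r := 0) (q' := ((H /ₘ f : Polynomial k⟦X⟧) : k⟦X⟧⟦X⟧)) (r' := H %ₘ f)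
        (by rw [Polynomial.degree_zero]; exact WithBot.bot_lt_coe _) hdeg (by
          rw [Polynomial.coe_zero, add_zero, ← hf.eq_mul, ← Polynomial.coe_mul,
            ← Polynomial.coe_add, add_comm, hdiv])
      exact h3.2.symm
    obtain ⟨q, hq⟩ := hdvd
    rcases hH.isUnit_or_isUnit hq with h | h
    · exact absurd (Polynomial.natDegree_eq_zero_of_isUnit h) hpos.ne'
    · rw [hq]; exact (associated_mul_unit_left f q h)

variable {L : Type*} [Field L] [Algebra k⟦X⟧ L] [FaithfulSMul k⟦X⟧ L]

/-- The integral closure of `k⟦X⟧` in an algebraic extension is a valuation ring, and its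
nonunits are topologically nilpotent. -/
theorem isIntegral_inv_or_pow_eq {z : L} (hz : IsAlgebraic k⟦X⟧ z) :
    IsIntegral k⟦X⟧ z⁻¹ ∨ IsIntegral k⟦X⟧ z ∧
      ∃ n, 0 < n ∧ ∃ y : L, IsIntegral k⟦X⟧ y ∧ z ^ n = algebraMap k⟦X⟧ L X * y := by
  have hinj := FaithfulSMul.algebraMap_injective k⟦X⟧ L
  obtain ⟨P, hP0, hP⟩ := hz
  obtain ⟨H, hH, hHz⟩ : ∃ H : Polynomial k⟦X⟧, Irreducible H ∧ Polynomial.aeval z H = 0 := by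
    obtain ⟨s, hs, u, hu⟩ := UniqueFactorizationMonoid.exists_prime_factors P hP0
    rw [← hu, map_mul] at hP
    have h1 : Polynomial.aeval z s.prod = 0 :=
      (mul_eq_zero.mp hP).resolve_right (((u.isUnit).map (Polynomial.aeval z)).ne_zero)
    rw [map_multiset_prod, Multiset.prod_eq_zero_iff, Multiset.mem_map] at h1
    obtain ⟨H, hHs, hH⟩ := h1
    exact ⟨H, (hs H hHs).irreducible, hH⟩
  have hX : ¬ Polynomial.C X ∣ H := by
    rintro ⟨q, rfl⟩
    rcases hH.isUnit_or_isUnit rfl with h | h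
    · exact X_prime.not_isUnit (Polynomial.isUnit_C.mp h)
    · rw [map_mul, Polynomial.aeval_C] at hHz
      rcases mul_eq_zero.mp hHz with h1 | h1
      · exact X_ne_zero (hinj (by rw [h1, map_zero]))
      · exact (h.map (Polynomial.aeval z)).ne_zero h1
  rcases constantCoeff_isUnit_or_exists_distinguished hH hX with h0 | ⟨f, hf, hpos, hass⟩
  · left
    rcases eq_or_ne z 0 with rfl | hz0
    · rw [inv_zero]; exact isIntegral_zero
    -- The reversed polynomial annihilates z⁻¹ and has the unit H(0) as leading coefficient.
    · obtain ⟨u, hu⟩ := h0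
      refine ⟨Polynomial.C (↑u⁻¹ : k⟦X⟧) * H.reverse, ?_, ?_⟩
      · have h1 : H.trailingCoeff = H.coeff 0 := by
          rw [Polynomial.trailingCoeff, Polynomial.natTrailingDegree_eq_zero.mpr]
          right; rw [← hu]; exact u.ne_zero
        rw [Polynomial.Monic, Polynomial.leadingCoeff_mul, Polynomial.leadingCoeff_C,
          Polynomial.reverse_leadingCoeff, h1, ← hu, Units.inv_mul]
      · rw [Polynomial.eval₂_mul]
        have h2 : Polynomial.eval₂ (algebraMap k⟦X⟧ L) z⁻¹ H.reverse = 0 := by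
          let := invertibleOfNonzero hz0
          rw [← invOf_eq_inv]
          exact (Polynomial.eval₂_reverse_eq_zero_iff (algebraMap k⟦X⟧ L) z H).mpr hHz
        rw [h2, mul_zero]
  · right
    have hfz : Polynomial.aeval z f = 0 := by
      obtain ⟨u, rfl⟩ := hass
      rw [map_mul, hHz, zero_mul]
    have hzi : IsIntegral k⟦X⟧ z := ⟨f, hf.monic, hfz⟩
    refine ⟨hzi, f.natDegree, hpos, ?_⟩
    have hc : ∀ i ∈ Finset.range f.natDegree, ∃ b : k⟦X⟧, f.coeff i = X * b := by
      intro i hi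
      have := hf.mem (Finset.mem_range.mp hi)
      rw [PowerSeries.maximalIdeal_eq_span_X, Ideal.mem_span_singleton] at this
      exact this
    choose! b hb using hc
    refine ⟨-∑ i ∈ Finset.range f.natDegree, algebraMap k⟦X⟧ L (b i) * z ^ i, ?_, ?_⟩
    · exact (IsIntegral.sum _ fun i _ => (isIntegral_algebraMap).mul (hzi.pow i)).neg
    · rw [Polynomial.aeval_eq_sum_range, Finset.sum_range_succ, hf.monic.coeff_natDegree,
        one_smul] at hfz
      rw [mul_neg, Finset.mul_sum, eq_neg_iff_add_eq_zero, add_comm, ← hfz]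
      congr 1
      refine Finset.sum_congr rfl fun i hi => ?_
      rw [hb i hi, Algebra.smul_def, map_mul, mul_assoc]

end ValuationRing

/-! ### Uniformizer and residues in a finite extension of the field of Laurent series. -/

section Uniformizer

variable {k : Type*} [Field k]
variable (F : Type*) {L : Type*} [Field F] [Field L] [Algebra k⟦X⟧ F] [IsFractionRing k⟦X⟧ F]
  [Algebra k⟦X⟧ L] [Algebra F L] [IsScalarTower k⟦X⟧ F L] [FiniteDimensional F L]

include F

/-- The order of this norm serves below as a discrete substitute for the valuation of L. -/
theorem exists_norm_eq {z : L} (hz : IsIntegral k⟦X⟧ z) :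
    ∃ d : k⟦X⟧, algebraMap k⟦X⟧ F d = Algebra.norm F z :=
  IsIntegrallyClosed.isIntegral_iff.mp (Algebra.isIntegral_norm F hz)

theorem norm_algebraMap_powerSeries (a : k⟦X⟧) :
    Algebra.norm F (algebraMap k⟦X⟧ L a) = algebraMap k⟦X⟧ F (a ^ Module.finrank F L) := by
  rw [IsScalarTower.algebraMap_apply k⟦X⟧ F L, Algebra.norm_algebraMap, map_pow]

theorem faithfulSMul_of_finite_extension : FaithfulSMul k⟦X⟧ L := by
  rw [faithfulSMul_iff_algebraMap_injective, IsScalarTower.algebraMap_eq k⟦X⟧ F L]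
  exact (algebraMap F L).injective.comp (IsFractionRing.injective k⟦X⟧ F)

theorem isAlgebraic_of_finite_extension (z : L) : IsAlgebraic k⟦X⟧ z := by
  have : Algebra.IsAlgebraic F L := inferInstance
  exact (IsFractionRing.isAlgebraic_iff k⟦X⟧ F L).mpr (this.isAlgebraic z)

/-- Take norms in zⁿ = X y: the n-th power of N(z) is divisible by X. -/
theorem X_dvd_norm {z : L} (hz' : ¬ IsIntegral k⟦X⟧ z⁻¹)
    {d : k⟦X⟧} (hd : algebraMap k⟦X⟧ F d = Algebra.norm F z) : X ∣ d := by
  have := faithfulSMul_of_finite_extension (k := k) F (L := L)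
  obtain ⟨-, n, hn, y, hy, h⟩ :=
    (isIntegral_inv_or_pow_eq (isAlgebraic_of_finite_extension F z)).resolve_left hz'
  obtain ⟨b, hb⟩ := exists_norm_eq F hy
  have h1 : d ^ n = X ^ Module.finrank F L * b := by
    apply IsFractionRing.injective k⟦X⟧ F
    rw [map_pow, hd, ← map_pow, h, map_mul, norm_algebraMap_powerSeries, map_mul, hb]
  refine X_prime.dvd_of_dvd_pow (n := n) ?_
  rw [h1]
  exact Dvd.dvd.mul_right (dvd_pow_self _ Module.finrank_pos.ne') _

theorem norm_ne_zero_of_ne_zero {z : L} (hz : z ≠ 0)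
    {d : k⟦X⟧} (hd : algebraMap k⟦X⟧ F d = Algebra.norm F z) : d ≠ 0 := by
  rintro rfl
  rw [map_zero] at hd
  exact hz (Algebra.norm_eq_zero_iff.mp hd.symm)

theorem not_isIntegral_inv_X : ¬ IsIntegral k⟦X⟧ (algebraMap k⟦X⟧ L X)⁻¹ := by
  intro h
  have := faithfulSMul_of_finite_extension (k := k) F (L := L)
  have hX : algebraMap k⟦X⟧ L X ≠ 0 := fun h0 =>
    X_ne_zero (FaithfulSMul.algebraMap_injective k⟦X⟧ L (h0.trans (map_zero _).symm))
  obtain ⟨b, hb⟩ := exists_norm_eq F h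
  have h1 : X ^ Module.finrank F L * b = (1 : k⟦X⟧) := by
    apply IsFractionRing.injective k⟦X⟧ F
    rw [map_mul, hb, ← norm_algebraMap_powerSeries F (L := L), ← map_mul, mul_inv_cancel₀ hX,
      map_one, map_one]
  exact X_prime.not_isUnit (isUnit_of_dvd_one ((dvd_pow_self _ Module.finrank_pos.ne').trans
    (Dvd.intro _ h1)))

/-- Choose a nonzero nonunit t whose norm has least order. If z/t were not integral for a nonunit z,
then t/z would be a nonunit and N(t) = N(z) N(t/z) would give z a norm of smaller order. Each factor
t contributes at least 1 to the order of the norm, so only 0 is divisible by all powers of t. -/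
theorem exists_uniformizer : ∃ t : L, t ≠ 0 ∧ IsIntegral k⟦X⟧ t ∧ ¬ IsIntegral k⟦X⟧ t⁻¹ ∧
    (∀ z : L, IsIntegral k⟦X⟧ z → ¬ IsIntegral k⟦X⟧ z⁻¹ → IsIntegral k⟦X⟧ (z / t)) ∧
    ∀ z : L, (∀ n : ℕ, IsIntegral k⟦X⟧ (z / t ^ n)) → z = 0 := by
  have := faithfulSMul_of_finite_extension (k := k) F (L := L)
  have hX : algebraMap k⟦X⟧ L X ≠ 0 := fun h0 =>
    X_ne_zero (FaithfulSMul.algebraMap_injective k⟦X⟧ L (h0.trans (map_zero _).symm))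
  choose! N hN using fun (z : L) (hz : IsIntegral k⟦X⟧ z) => exists_norm_eq F hz
  have hmul : ∀ z w : L, IsIntegral k⟦X⟧ z → IsIntegral k⟦X⟧ w → N (z * w) = N z * N w := by
    intro z w hz hw
    apply IsFractionRing.injective k⟦X⟧ F
    rw [map_mul, hN _ hz, hN _ hw, hN _ (hz.mul hw), map_mul]
  obtain ⟨t, ⟨ht0, ht, ht'⟩, hmin⟩ := (InvImage.wf (fun z => (N z).order) wellFounded_lt).has_min
    {z : L | z ≠ 0 ∧ IsIntegral k⟦X⟧ z ∧ ¬ IsIntegral k⟦X⟧ z⁻¹}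
    ⟨algebraMap k⟦X⟧ L X, hX, isIntegral_algebraMap, not_isIntegral_inv_X F⟩
  have hone : ∀ z : L, IsIntegral k⟦X⟧ z → ¬ IsIntegral k⟦X⟧ z⁻¹ → 1 ≤ (N z).order := by
    intro z hz hz'
    have := X_dvd_norm F hz' (hN z hz)
    rw [← pow_one X, X_pow_dvd_iff_le_order] at this
    exact_mod_cast this
  have hfin : ∀ z : L, z ≠ 0 → IsIntegral k⟦X⟧ z → (N z).order ≠ ⊤ := by
    intro z hz0 hz
    rw [Ne, order_eq_top]
    exact norm_ne_zero_of_ne_zero F hz0 (hN z hz)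
  refine ⟨t, ht0, ht, ht', ?_, ?_⟩
  · intro z hz hz'
    have hz0 : z ≠ 0 := by
      rintro rfl; exact hz' (by rw [inv_zero]; exact isIntegral_zero)
    by_contra hcon
    have hs' : ¬ IsIntegral k⟦X⟧ (t / z)⁻¹ := by rwa [inv_div]
    have hs : IsIntegral k⟦X⟧ (t / z) :=
      ((isIntegral_inv_or_pow_eq (isAlgebraic_of_finite_extension F (t / z))).resolve_left hs').1
    have h1 : N t = N z * N (t / z) := by
      rw [← hmul _ _ hz hs, mul_div_cancel₀ _ hz0]
    have h2 := hmin z ⟨hz0, hz, hz'⟩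
    apply h2
    change (N z).order < (N t).order
    rw [h1, order_mul]
    have h3 := hone _ hs hs'
    exact (ENat.add_one_le_iff (hfin z hz0 hz)).mp (by gcongr)
  · intro z hz
    by_contra hz0
    have hzi : IsIntegral k⟦X⟧ z := by simpa using hz 0
    obtain ⟨n, hn⟩ := ENat.ne_top_iff_exists.mp (hfin z hz0 hzi)
    have h1 : N z = N t ^ (n + 1) * N (z / t ^ (n + 1)) := by
      have : ∀ m : ℕ, N (t ^ m) = N t ^ m := by
        intro m
        apply IsFractionRing.injective k⟦X⟧ F
        rw [map_pow, hN _ ht, hN _ (ht.pow m), map_pow]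
      rw [← this, ← hmul _ _ (ht.pow _) (hz _), mul_div_cancel₀ _ (pow_ne_zero _ ht0)]
    have h2 : ((n + 1 : ℕ) : ℕ∞) ≤ (N z).order := by
      rw [h1, order_mul, order_pow, nsmul_eq_mul]
      calc ((n + 1 : ℕ) : ℕ∞) = (n + 1 : ℕ) * 1 := (mul_one _).symm
        _ ≤ (n + 1 : ℕ) * (N t).order := by gcongr; exact hone _ ht ht'
        _ ≤ _ := le_self_add
    rw [← hn] at h2
    norm_cast at h2
    omega

variable [IsAlgClosed k] [Algebra k L] [IsScalarTower k k⟦X⟧ L]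

/-- Reduced modulo X, a monic equation of z splits over k, so ∏ (z - c) over its roots is a multiple
of X by an integral element. If all the (z - c)⁻¹ were integral, X⁻¹ would be too. -/
theorem exists_residue {z : L} (hz : IsIntegral k⟦X⟧ z) :
    ∃ c : k, z = algebraMap k L c ∨ ¬ IsIntegral k⟦X⟧ (z - algebraMap k L c)⁻¹ := by
  by_contra hcon
  push Not at hcon
  obtain ⟨f, hf, hfz⟩ := hz
  have := faithfulSMul_of_finite_extension (k := k) F (L := L)
  have hX : algebraMap k⟦X⟧ L X ≠ 0 := fun h0 =>
    X_ne_zero (FaithfulSMul.algebraMap_injective k⟦X⟧ L (h0.trans (map_zero _).symm))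
  have hdvd : Polynomial.C X ∣ f - (f.map constantCoeff).map (PowerSeries.C (R := k)) := by
    rw [Polynomial.C_dvd_iff_dvd_coeff]
    intro i
    rw [X_dvd_iff]; simp
  obtain ⟨g, hg⟩ := hdvd
  have hsplit := (IsAlgClosed.splits (f.map constantCoeff)).eq_prod_roots_of_monic (hf.map _)
  set s := (f.map (constantCoeff (R := k))).roots
  have h1 : (s.map fun c => z - algebraMap k L c).prod = - (algebraMap k⟦X⟧ L X * Polynomial.aeval z g) := by
    have h2 := congrArg (Polynomial.aeval z) hg
    rw [map_sub, Polynomial.aeval_def, hfz, zero_sub, map_mul, Polynomial.aeval_C] at h2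
    rw [← h2, neg_neg, hsplit, ← Polynomial.coe_mapRingHom, map_multiset_prod, map_multiset_prod,
      Multiset.map_map, Multiset.map_map]
    congr 1
    refine Multiset.map_congr rfl fun c _ => ?_
    simp only [Function.comp_apply, Polynomial.coe_mapRingHom, Polynomial.map_sub,
      Polynomial.map_X, Polynomial.map_C, map_sub, Polynomial.aeval_X, Polynomial.aeval_C]
    rw [IsScalarTower.algebraMap_apply k k⟦X⟧ L]; rfl
  have h3 : IsIntegral k⟦X⟧ (s.map fun c => z - algebraMap k L c).prod⁻¹ := by
    rw [← Multiset.prod_map_inv]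
    refine IsIntegral.multiset_prod fun y hy => ?_
    obtain ⟨c, -, rfl⟩ := Multiset.mem_map.mp hy
    exact (hcon c).2
  have hne : (s.map fun c => z - algebraMap k L c).prod ≠ 0 := by
    rw [Ne, Multiset.prod_eq_zero_iff, Multiset.mem_map]
    rintro ⟨c, -, hc⟩
    exact (hcon c).1 (sub_eq_zero.mp hc)
  apply not_isIntegral_inv_X (k := k) F (L := L)
  have h4 : (algebraMap k⟦X⟧ L X)⁻¹ =
      - (Polynomial.aeval z g * (s.map fun c => z - algebraMap k L c).prod⁻¹) := by
    rw [inv_eq_iff_eq_inv, eq_comm, ← mul_eq_one_iff_inv_eq₀]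
    · rw [← mul_right_inj' hne]
      field_simp
      rw [h1]; ring
    · intro h0
      have h5 : Polynomial.aeval z g = 0 := by
        simpa [_root_.inv_eq_zero, hne] using h0
      rw [h5, mul_zero, neg_zero] at h1
      exact hne h1
  rw [h4]
  refine (IsIntegral.mul ?_ h3).neg
  have hzi : IsIntegral k⟦X⟧ z := ⟨f, hf, hfz⟩
  rw [Polynomial.aeval_eq_sum_range]
  exact IsIntegral.sum _ fun i _ => (hzi.pow i).smul _

end Uniformizer

/-! ### Embedding of a ring with uniformizer in `k⟦X⟧`. -/

section Embedding

variable {k O : Type*} [Field k] [CommRing O] [IsDomain O] [Algebra k O]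

/-- Since t is not a unit, residues are unique, and uniqueness turns the choice of residues into a
homomorphism. -/
theorem exists_residueHom {t : O} (ht : ¬ IsUnit t) (h : ∀ z : O, ∃ c : k, t ∣ z - algebraMap k O c) :
    ∃ c : O →ₐ[k] k, ∀ z, t ∣ z - algebraMap k O (c z) := by
  choose c hc using h
  have huniq : ∀ z a, t ∣ z - algebraMap k O a → c z = a := by
    intro z a ha
    by_contra hne
    have h1 : t ∣ algebraMap k O (c z - a) := by
      have := dvd_sub ha (hc z)
      rw [sub_sub_sub_cancel_left] at this
      rwa [map_sub]
    exact ht (isUnit_of_dvd_unit h1 ((isUnit_iff_ne_zero.mpr (sub_ne_zero.mpr hne)).map _))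
  refine ⟨⟨⟨⟨⟨c, ?_⟩, ?_⟩, ?_, ?_⟩, ?_⟩, hc⟩
  · exact huniq _ _ (by simp)
  · intro z w
    refine huniq _ _ ?_
    have : z * w - algebraMap k O (c z * c w) = (z - algebraMap k O (c z)) * w +
        algebraMap k O (c z) * (w - algebraMap k O (c w)) := by rw [map_mul]; ring
    change t ∣ z * w - algebraMap k O (c z * c w)
    rw [this]
    exact dvd_add ((hc z).mul_right _) ((hc w).mul_left _)
  · exact huniq _ _ (by simp)
  · intro z w
    refine huniq _ _ ?_
    change t ∣ z + w - algebraMap k O (c z + c w)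
    rw [map_add, add_sub_add_comm]
    exact dvd_add (hc z) (hc w)
  · exact fun a => huniq _ _ (by simp)

theorem exists_embedding {t : O} (ht0 : t ≠ 0) (ht : ¬ IsUnit t)
    (h : ∀ z : O, ∃ c : k, t ∣ z - algebraMap k O c) (hH : ∀ z : O, (∀ n : ℕ, t ^ n ∣ z) → z = 0) :
    ∃ ψ : O →ₐ[k] k⟦X⟧, Function.Injective ψ ∧ ψ t = X := by
  obtain ⟨c, hc⟩ := exists_residueHom ht h
  refine ⟨digitsHom hc ht0, ?_, digitsHom_uniformizer hc ht0 ?_⟩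
  · rw [injective_iff_map_eq_zero]
    exact fun z hz => hH z fun n => pow_dvd_of_digits_eq_zero hc z hz n
  · by_contra hne
    have h1 := (dvd_sub_right (dvd_refl t)).mp (hc t)
    exact ht (isUnit_of_dvd_unit h1 ((isUnit_iff_ne_zero.mpr hne).map _))

end Embedding

/-! ### Finite domains over `k⟦X⟧` and their conductor. -/

section Normalization

variable {k : Type*} [Field k] [IsAlgClosed k]

theorem dvd_iff_isIntegral_div {R L : Type*} [CommRing R] [Field L] [Algebra R L]
    {t z : integralClosure R L} (ht : (t : L) ≠ 0) : t ∣ z ↔ IsIntegral R ((z : L) / t) := by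
  constructor
  · rintro ⟨y, rfl⟩
    rw [MulMemClass.coe_mul, mul_div_cancel_left₀ _ ht]
    exact y.2
  · intro h
    exact ⟨⟨_, h⟩, Subtype.ext (mul_div_cancel₀ _ ht).symm⟩

/-- A domain finite over `k⟦X⟧` embeds in a power series ring with conductor. -/
theorem exists_injective_of_finite (A : Type*) [CommRing A] [IsDomain A] [Algebra k A]
    [Algebra k⟦X⟧ A] [IsScalarTower k k⟦X⟧ A] [Module.Finite k⟦X⟧ A] [FaithfulSMul k⟦X⟧ A] :
    ∃ ψ : A →ₐ[k] k⟦X⟧, Function.Injective ψ ∧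
      ∃ c : ℕ, ∀ z : k⟦X⟧, X ^ c ∣ z → ∃ a, ψ a = z := by
  let F := FractionRing k⟦X⟧
  let L := FractionRing A
  have : FaithfulSMul k⟦X⟧ L := FaithfulSMul.trans k⟦X⟧ A L
  let _ : Algebra F L := FractionRing.liftAlgebra k⟦X⟧ L
  have : IsScalarTower k⟦X⟧ F L := FractionRing.isScalarTower_liftAlgebra k⟦X⟧ L
  have : Algebra.IsAlgebraic k⟦X⟧ A := inferInstance
  have : IsLocalization (Algebra.algebraMapSubmonoid A (nonZeroDivisors k⟦X⟧)) L := inferInstance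
  have : Module.Finite F L := Module.Finite.of_isLocalization k⟦X⟧ A (nonZeroDivisors k⟦X⟧)
  have hinj := FaithfulSMul.algebraMap_injective k⟦X⟧ L
  have hinjA := FaithfulSMul.algebraMap_injective A L
  have hX : algebraMap k⟦X⟧ L X ≠ 0 := fun h0 =>
    X_ne_zero (hinj (h0.trans (map_zero _).symm))
  obtain ⟨t, ht0, ht, ht', hdiv, hHaus⟩ := exists_uniformizer (k := k) F (L := L)
  let O := integralClosure k⟦X⟧ L
  let τ : O := ⟨t, ht⟩
  have hτ0 : τ ≠ 0 := fun h => ht0 (congrArg Subtype.val h)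
  have hτu : ¬ IsUnit τ := by
    intro h
    obtain ⟨y, hy⟩ := isUnit_iff_dvd_one.mp h
    apply ht'
    have h1 : (1 : L) = t * y := congrArg Subtype.val hy
    rw [inv_eq_of_mul_eq_one_right h1.symm]
    exact y.2
  have hres : ∀ z : O, ∃ c : k, τ ∣ z - algebraMap k O c := by
    intro z
    obtain ⟨c, hc⟩ := exists_residue F z.2
    refine ⟨c, ?_⟩
    rw [dvd_iff_isIntegral_div ht0]
    have hcoe : ((z - algebraMap k O c : O) : L) = z - algebraMap k L c := rfl
    rw [hcoe]
    rcases hc with hc | hc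
    · rw [hc, sub_self, zero_div]; exact isIntegral_zero
    · exact hdiv _ (z - algebraMap k O c).2 hc
  obtain ⟨ψ, hψ, hψτ⟩ := exists_embedding hτ0 hτu hres fun z hz => by
    apply Subtype.ext
    refine hHaus _ fun n => ?_
    exact (dvd_iff_isIntegral_div (t := τ ^ n) (pow_ne_zero n ht0)).mp (hz n)
  let θ : k⟦X⟧ →ₐ[k] k⟦X⟧ := ψ.comp (IsScalarTower.toAlgHom k k⟦X⟧ O)
  have hθinj : Function.Injective θ := hψ.comp fun a b hab => hinj (congrArg Subtype.val hab)
  have hθX : θ X ≠ 0 := fun h => X_ne_zero (hθinj (h.trans (map_zero _).symm))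
  obtain ⟨e, he⟩ := ENat.ne_top_iff_exists.mp (mt order_eq_top.mp hθX)
  have hepos : 0 < e := by
    have h1 : τ ∣ algebraMap k⟦X⟧ O X :=
      (dvd_iff_isIntegral_div ht0).mpr (hdiv _ isIntegral_algebraMap (not_isIntegral_inv_X F))
    have h2 := map_dvd ψ h1
    rw [hψτ] at h2
    have h3 := (X_pow_dvd_iff_le_order (n := 1) (z := θ X)).mp (by rw [pow_one]; exact h2)
    rw [← he] at h3
    exact_mod_cast h3
  -- A common denominator s of 1, t, …, t^(e-1) relative to A. These powers map to generators of
  -- `k⟦X⟧` over the image of θ, so all multiples of θ s come from A, and the order of θ s is an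
  -- admissible c.
  obtain ⟨s, hs0, hs⟩ : ∃ s : k⟦X⟧, s ≠ 0 ∧ ∀ i : Fin e, ∃ a : A,
      algebraMap k⟦X⟧ L s * t ^ (i : ℕ) = algebraMap A L a := by
    have h1 : ∀ i : Fin e, ∃ s : k⟦X⟧, s ≠ 0 ∧ ∃ a : A,
        algebraMap k⟦X⟧ L s * t ^ (i : ℕ) = algebraMap A L a := by
      intro i
      obtain ⟨a, b, hb, hab⟩ := IsFractionRing.div_surjective (A := A) (t ^ (i : ℕ))
      obtain ⟨s, hs0, y, hy⟩ :=
        (Algebra.IsAlgebraic.isAlgebraic (R := k⟦X⟧) b).exists_nonzero_dvd hb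
      have hb0 : algebraMap A L b ≠ 0 := fun h =>
        nonZeroDivisors.ne_zero hb (hinjA (h.trans (map_zero _).symm))
      refine ⟨s, hs0, y * a, ?_⟩
      rw [← hab, IsScalarTower.algebraMap_apply k⟦X⟧ A L, hy, map_mul, map_mul, mul_comm (algebraMap A L b),
        mul_assoc, mul_div_cancel₀ _ hb0]
    choose s hs0 a ha using h1
    refine ⟨∏ i, s i, Finset.prod_ne_zero_iff.mpr fun i _ => hs0 i, fun i =>
      ⟨algebraMap k⟦X⟧ A (∏ j ∈ Finset.univ.erase i, s j) * a i, ?_⟩⟩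
    rw [← Finset.prod_erase_mul _ _ (Finset.mem_univ i), map_mul, mul_assoc, ha, map_mul,
      ← IsScalarTower.algebraMap_apply]
  choose a ha using hs
  let ι : A →ₐ[k] O :=
    { toFun := fun x => ⟨algebraMap A L x, (Algebra.IsIntegral.isIntegral (R := k⟦X⟧) x).algebraMap⟩
      map_one' := Subtype.ext (map_one _)
      map_zero' := Subtype.ext (map_zero _)
      map_mul' := fun x y => Subtype.ext (map_mul _ x y)
      map_add' := fun x y => Subtype.ext (map_add _ x y)
      commutes' := fun c => Subtype.ext (IsScalarTower.algebraMap_apply k A L c).symm }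
  refine ⟨ψ.comp ι, hψ.comp fun x y hxy => hinjA (congrArg Subtype.val hxy), ?_⟩
  have hθs : θ s ≠ 0 := fun h => hs0 (hθinj (h.trans (map_zero _).symm))
  obtain ⟨c, hc⟩ := ENat.ne_top_iff_exists.mp (mt order_eq_top.mp hθs)
  refine ⟨c, fun z hz => ?_⟩
  rw [X_pow_dvd_iff_le_order, hc, ← dvd_iff_order_le] at hz
  obtain ⟨y, rfl⟩ := hz
  obtain ⟨b, hb, -⟩ := exists_decomposition θ hepos he.symm y
  refine ⟨∑ i, algebraMap k⟦X⟧ A (b i) * a i, ?_⟩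
  have h1 : ι (∑ i, algebraMap k⟦X⟧ A (b i) * a i) =
      algebraMap k⟦X⟧ O s * ∑ i, algebraMap k⟦X⟧ O (b i) * τ ^ (i : ℕ) := by
    apply Subtype.ext
    change algebraMap A L _ = algebraMap k⟦X⟧ L s * ((∑ i, algebraMap k⟦X⟧ O (b i) * τ ^ (i : ℕ) : O) : L)
    rw [AddSubmonoidClass.coe_finsetSum, Finset.mul_sum, map_sum]
    refine Finset.sum_congr rfl fun i _ => ?_
    rw [map_mul, ← ha, ← IsScalarTower.algebraMap_apply]
    change _ = algebraMap k⟦X⟧ L s * (algebraMap k⟦X⟧ L (b i) * t ^ (i : ℕ))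
    ring
  change ψ (ι _) = _
  rw [h1, map_mul, map_sum]
  conv_rhs => rw [hb]
  simp only [map_mul, map_pow, hψτ]
  rfl

end Normalization

/-! ### Parametrization of a branch. -/

section Parametrization

variable {K : Type*} [Field K] [IsAlgClosed K]

theorem map_constantCoeff_eq_zero_iff {g : K⟦X⟧⟦X⟧} :
    g.map (constantCoeff (R := K)) = 0 ↔ PowerSeries.C X ∣ g := by
  constructor
  · intro h
    have h1 : ∀ i, ∃ b, coeff i g = X * b := by
      intro i
      have := congrArg (coeff i) h
      rw [coeff_map, map_zero] at this
      exact X_dvd_iff.mpr this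
    choose b hb using h1
    refine ⟨PowerSeries.mk b, ?_⟩
    ext1 i
    rw [coeff_C_mul, coeff_mk, hb]
  · rintro ⟨q, rfl⟩
    rw [map_mul, map_C]; simp

theorem not_isUnit_C_X : ¬ IsUnit (PowerSeries.C X : K⟦X⟧⟦X⟧) := by
  rw [isUnit_iff_constantCoeff, constantCoeff_C]
  exact X_prime.not_isUnit

theorem exists_quotient_ringEquiv {A : Type*} [CommRing A] [IsLocalRing A]
    [IsAdicComplete (IsLocalRing.maximalIdeal A) A] {g h : A⟦X⟧} {f : Polynomial A}
    (H : g.IsWeierstrassFactorization f h) :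
    ∃ E : (Polynomial A ⧸ Ideal.span {f}) ≃+* (A⟦X⟧ ⧸ Ideal.span {g}), ∀ d : A,
      E (Ideal.Quotient.mk _ (Polynomial.C d)) = Ideal.Quotient.mk _ (PowerSeries.C d) :=
  ⟨H.algEquivQuotient.toRingEquiv, fun d => H.algEquivQuotient.commutes d⟩

/-- If p is associated to the inner variable, set that variable to 0. Otherwise p is nonzero modulo
it, and Weierstrass preparation presents the quotient as a finite domain over `K⟦X⟧`. -/
theorem exists_parametrization_of_prime (p : K⟦X⟧⟦X⟧) (hp : Prime p) :
    ∃ φ : K⟦X⟧⟦X⟧ →ₐ[K] K⟦X⟧, (∀ g, φ g = 0 ↔ p ∣ g) ∧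
      ∃ c : ℕ, ∀ z : K⟦X⟧, X ^ c ∣ z → ∃ g, φ g = z := by
  by_cases hX : p ∣ PowerSeries.C X
  · have hpX : PowerSeries.C X ∣ p := by
      obtain ⟨q, hq⟩ := hX
      have h1 := map_constantCoeff_eq_zero_iff.mpr (dvd_refl (PowerSeries.C (X : K⟦X⟧)))
      rw [hq, map_mul, mul_eq_zero] at h1
      rcases h1 with h1 | h1
      · exact map_constantCoeff_eq_zero_iff.mp h1
      · obtain ⟨r, rfl⟩ := map_constantCoeff_eq_zero_iff.mp h1
        have h2 : (PowerSeries.C X : K⟦X⟧⟦X⟧) * 1 = PowerSeries.C X * (p * r) := by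
          rw [mul_one]; linear_combination hq
        have h3 : (PowerSeries.C X : K⟦X⟧⟦X⟧) ≠ 0 := fun h =>
          X_ne_zero (C_injective (h.trans (map_zero _).symm))
        exact absurd (isUnit_of_dvd_one ⟨r, mul_left_cancel₀ h3 h2⟩) hp.not_isUnit
    refine ⟨mapAlgHom ⟨constantCoeff, fun r => by simp⟩, fun g => ?_, 0, fun z _ => ?_⟩
    · exact map_constantCoeff_eq_zero_iff.trans ⟨hX.trans, hpX.trans⟩
    · refine ⟨z.map PowerSeries.C, ?_⟩
      ext n
      change coeff n ((z.map PowerSeries.C).map (constantCoeff (R := K))) = _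
      simp
  · have hne : p.map (IsLocalRing.residue K⟦X⟧) ≠ 0 := by
      intro h
      have h1 : PowerSeries.C X ∣ p := by
        rw [← map_constantCoeff_eq_zero_iff]
        ext i
        have := congrArg (coeff i) h
        rw [coeff_map, map_zero, residue_eq_zero_iff, X_dvd_iff] at this
        rw [coeff_map, this, map_zero]
      obtain ⟨r, hr⟩ := h1
      rcases hp.irreducible.isUnit_or_isUnit hr with h | h
      · exact not_isUnit_C_X h
      · exact hX ((h.dvd_mul_right).mp (by rw [← hr]))
    have := isAdicComplete_maximalIdeal (k := K)
    obtain ⟨f, U, hf⟩ := exists_isWeierstrassFactorization hne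
    have hfin : Module.Finite K⟦X⟧ (Polynomial K⟦X⟧ ⧸ Ideal.span {f}) :=
      hf.isDistinguishedAt.monic.finite_quotient
    obtain ⟨E, hEC⟩ := exists_quotient_ringEquiv hf
    have : IsDomain (K⟦X⟧⟦X⟧ ⧸ Ideal.span {p}) := by
      rw [Ideal.Quotient.isDomain_iff_prime, Ideal.span_singleton_prime hp.ne_zero]
      exact hp
    have : IsDomain (Polynomial K⟦X⟧ ⧸ Ideal.span {f}) := E.toMulEquiv.isDomain _
    have : FaithfulSMul K⟦X⟧ (Polynomial K⟦X⟧ ⧸ Ideal.span {f}) := by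
      refine (faithfulSMul_iff_algebraMap_injective _ _).mpr
        ((injective_iff_map_eq_zero
          (algebraMap K⟦X⟧ (Polynomial K⟦X⟧ ⧸ Ideal.span {f}))).mpr fun d hd => ?_)
      by_contra hd0
      obtain ⟨n, hn⟩ := ENat.ne_top_iff_exists.mp (mt order_eq_top.mp hd0)
      obtain ⟨e, he, rfl⟩ := exists_eq_X_pow_mul_isUnit hn.symm
      have h1 : p ∣ PowerSeries.C (X ^ n * e) := by
        rw [← Ideal.mem_span_singleton, ← Ideal.Quotient.eq_zero_iff_mem, ← hEC]
        exact (congrArg E hd).trans (map_zero E)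
      rw [map_mul, (he.map (PowerSeries.C (R := K⟦X⟧))).dvd_mul_right, map_pow] at h1
      exact hX (hp.dvd_of_dvd_pow h1)
    obtain ⟨ψ, hψ, c, hc⟩ := exists_injective_of_finite (k := K) (Polynomial K⟦X⟧ ⧸ Ideal.span {f})
    refine ⟨{ (ψ : _ →+* K⟦X⟧).comp
        (E.symm.toRingHom.comp (Ideal.Quotient.mk (Ideal.span {p}))) with
      commutes' := fun r => ?_ }, fun g => ?_, c, fun z hz => ?_⟩
    · have h1 : algebraMap K K⟦X⟧⟦X⟧ r = PowerSeries.C (PowerSeries.C r) :=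
        PowerSeries.algebraMap_apply
      change ψ (E.symm (Ideal.Quotient.mk _ (algebraMap K K⟦X⟧⟦X⟧ r))) = _
      rw [h1, ← hEC, RingEquiv.symm_apply_apply]
      exact ψ.commutes r
    · change ψ (E.symm (Ideal.Quotient.mk _ g)) = 0 ↔ _
      rw [map_eq_zero_iff ψ hψ, map_eq_zero_iff E.symm E.symm.injective,
        Ideal.Quotient.eq_zero_iff_mem, Ideal.mem_span_singleton]
    · obtain ⟨a, ha⟩ := hc z hz
      obtain ⟨g, hg⟩ := Ideal.Quotient.mk_surjective (E a)
      refine ⟨g, ?_⟩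
      change ψ (E.symm (Ideal.Quotient.mk _ g)) = z
      rw [hg, E.symm_apply_apply, ha]

theorem exists_parametrization {p : Series K} (hp : Irreducible p) :
    ∃ φ : Series K →ₐ[K] K⟦X⟧, (∀ g, φ g = 0 ↔ p ∣ g) ∧
      ∃ c : ℕ, ∀ z : K⟦X⟧, X ^ c ∣ z → ∃ g, φ g = z := by
  let e : Series K ≃ₐ[K] K⟦X⟧⟦X⟧ :=
    (MvPowerSeries.renameEquiv K (finSuccEquiv 1 |>.trans (Equiv.optionCongr (Equiv.ofUnique _ Unit)))).trans
      (MvPowerSeries.optionEquivLeft Unit K)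
  have hp' : Irreducible (e p) := (MulEquiv.irreducible_iff e.toMulEquiv).mpr hp
  obtain ⟨φ, hφ, c, hc⟩ := exists_parametrization_of_prime (e p) hp'.prime
  refine ⟨φ.comp e, fun g => (hφ _).trans ?_, c, fun z hz => ?_⟩
  · exact map_dvd_iff e
  · obtain ⟨g, hg⟩ := hc z hz
    exact ⟨e.symm g, by simp [hg]⟩

end Parametrization

/-! ### Lengths of quotient spaces. -/

section Length

theorem length_quotient_eq_add {K V W : Type*} [Field K] [AddCommGroup V] [Module K V]
    [AddCommGroup W] [Module K W] (f : V →ₗ[K] W) (N : Submodule K V) (M : Submodule K W)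
    (h : N = M.comap f) : Module.length K (W ⧸ M) =
      Module.length K (V ⧸ N) + Module.length K (W ⧸ (M ⊔ LinearMap.range f)) := by
  subst h
  refine Module.length_eq_add_of_exact ((M.comap f).mapQ M f le_rfl) (Submodule.factor le_sup_left)
    ?_ (Submodule.factor_surjective _) ?_
  · rw [← LinearMap.ker_eq_bot, Submodule.ker_mapQ]
    · simp
  · intro x
    obtain ⟨x, rfl⟩ := Submodule.mkQ_surjective _ x
    have h0 : Submodule.factor le_sup_left (M.mkQ x) = 0 ↔ x ∈ M ⊔ LinearMap.range f :=
      Submodule.Quotient.mk_eq_zero _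
    rw [h0, Submodule.mem_sup, Submodule.mkQ_apply, Set.mem_range]
    constructor
    · rintro ⟨m, hm, _, ⟨v, rfl⟩, rfl⟩
      refine ⟨Submodule.Quotient.mk v, ?_⟩
      rw [Submodule.mapQ_apply, eq_comm, Submodule.Quotient.eq]
      simpa using hm
    · rintro ⟨y, hy⟩
      obtain ⟨v, rfl⟩ := Submodule.mkQ_surjective _ y
      rw [Submodule.mkQ_apply, Submodule.mapQ_apply, eq_comm, Submodule.Quotient.eq] at hy
      exact ⟨x - f v, hy, f v, ⟨v, rfl⟩, by abel⟩

variable {K : Type*} [Field K]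

theorem length_quotient_of_order_eq {h : K⟦X⟧} {n : ℕ} (hh : h.order = n) :
    Module.length K (K⟦X⟧ ⧸ LinearMap.range (LinearMap.mulLeft K h)) = n := by
  let f : K⟦X⟧ →ₗ[K] (Fin n → K) := LinearMap.pi fun i => coeff (i : ℕ)
  have hf : LinearMap.ker f = LinearMap.range (LinearMap.mulLeft K h) := by
    ext z
    rw [LinearMap.mem_ker, LinearMap.mem_range]
    have h1 : (∃ y, LinearMap.mulLeft K h y = z) ↔ h ∣ z :=
      ⟨fun ⟨y, hy⟩ => ⟨y, hy.symm⟩, fun ⟨y, hy⟩ => ⟨y, hy.symm⟩⟩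
    rw [h1, dvd_iff_order_le, hh, ← X_pow_dvd_iff_le_order, X_pow_dvd_iff]
    exact ⟨fun h2 m hm => congrFun h2 ⟨m, hm⟩, fun h2 => funext fun i => h2 i i.2⟩
  have hs : Function.Surjective f := by
    intro v
    refine ⟨PowerSeries.mk fun i => if hi : i < n then v ⟨i, hi⟩ else 0, ?_⟩
    funext i
    simp [f]
  have e := (Submodule.quotEquivOfEq _ _ hf.symm).trans (f.quotKerEquivOfSurjective hs)
  rw [e.length_eq, Module.length_eq_finrank]
  simp

end Length

/-! ### Intersection numbers as orders along a parametrization. -/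

section Intersection

variable {K : Type*} [Field K]

theorem intersectionNumber_comm (f g : Series K) :
    intersectionNumber f g = intersectionNumber g f := by
  unfold intersectionNumber
  rw [Set.pair_comm]

theorem intersectionNumber_eq_length (f g : Series K) : intersectionNumber f g =
    Module.length K (Series K ⧸ (Ideal.span ({f, g} : Set (Series K))).restrictScalars K) := by
  rw [intersectionNumber, ← Module.length_eq_rank]
  exact (Submodule.Quotient.restrictScalarsEquiv K _).length_eq.symm

theorem intersectionNumber_le_of_dvd {f g h : Series K} (hd : g ∣ h) :
    intersectionNumber f g ≤ intersectionNumber f h := by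
  rw [intersectionNumber_eq_length, intersectionNumber_eq_length]
  have hle : (Ideal.span ({f, h} : Set (Series K))).restrictScalars K ≤
      (Ideal.span ({f, g} : Set (Series K))).restrictScalars K := by
    intro x hx
    rw [Submodule.restrictScalars_mem] at hx ⊢
    refine (Ideal.span_le.mpr ?_ : Ideal.span {f, h} ≤ _) hx
    rintro y (rfl | rfl)
    · exact Ideal.subset_span (by simp)
    · exact Ideal.mem_of_dvd _ hd (Ideal.subset_span (by simp))
  exact Module.length_le_of_surjective _ (Submodule.factor_surjective hle)

variable [IsAlgClosed K] {p : Series K} (hp : Irreducible p)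

/-- A parametrization of the branch `{p = 0}`. -/
def param : Series K →ₐ[K] K⟦X⟧ := (exists_parametrization hp).choose

theorem param_eq_zero_iff {g : Series K} : param hp g = 0 ↔ p ∣ g :=
  (exists_parametrization hp).choose_spec.1 g

theorem exists_conductor_exponent : ∃ c : ℕ, ∀ z : K⟦X⟧, X ^ c ∣ z → ∃ g, param hp g = z :=
  (exists_parametrization hp).choose_spec.2

include hp

/-- The parametrization embeds the quotient by p in a domain. -/
theorem prime_of_irreducible : Prime p := by
  refine ⟨hp.ne_zero, hp.not_isUnit, fun a b hab => ?_⟩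
  rw [← param_eq_zero_iff hp, map_mul, mul_eq_zero] at hab
  simpa only [← param_eq_zero_iff hp] using hab

/-- With φ the parametrization and A its image, compute the length of `K⟦X⟧` modulo φ(g)A twice:
through φ it is (p,g)₀ plus the codimension of A, through multiplication by φ(g) it is that
codimension plus ord φ(g). The conductor makes the codimension finite, so it cancels. -/
theorem intersectionNumber_eq_order_of_ne_zero {g : Series K} (hg : param hp g ≠ 0) :
    intersectionNumber p g = (param hp g).order := by
  obtain ⟨n, hn⟩ := ENat.ne_top_iff_exists.mp (mt order_eq_top.mp hg)
  obtain ⟨c, hc⟩ := exists_conductor_exponent hp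
  let A : Submodule K K⟦X⟧ := LinearMap.range (param hp).toLinearMap
  have hA : ∀ z, z ∈ A ↔ ∃ r, param hp r = z := fun z => Iff.rfl
  let μ := LinearMap.mulLeft K (param hp g)
  have hμ : ∀ z, μ z = param hp g * z := fun z => rfl
  have hfin : Module.length K (K⟦X⟧ ⧸ A) ≠ ⊤ := by
    have h1 : LinearMap.range (LinearMap.mulLeft K ((X : K⟦X⟧) ^ c)) ≤ A := by
      rintro _ ⟨y, rfl⟩
      exact hc _ ⟨y, rfl⟩
    have h2 := Module.length_le_of_surjective _ (Submodule.factor_surjective h1)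
    rw [length_quotient_of_order_eq (order_X_pow c)] at h2
    exact ne_top_of_le_ne_top (ENat.natCast_ne_top c) h2
  have e1 := length_quotient_eq_add (param hp).toLinearMap
    ((Ideal.span ({p, g} : Set (Series K))).restrictScalars K) (A.map μ) (by
      ext r
      rw [Submodule.restrictScalars_mem, Ideal.mem_span_pair, Submodule.mem_comap,
        Submodule.mem_map]
      constructor
      · rintro ⟨a, b, rfl⟩
        refine ⟨param hp b, ⟨b, rfl⟩, ?_⟩
        have : param hp p = 0 := (param_eq_zero_iff hp).mpr dvd_rfl
        simp [hμ, this, mul_comm]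
      · rintro ⟨_, ⟨b, rfl⟩, h⟩
        have h1 : param hp (r - b * g) = 0 := by
          rw [map_sub, map_mul]
          have : param hp g * param hp b = param hp r := h
          rw [← this]; ring
        obtain ⟨a, ha⟩ := (param_eq_zero_iff hp).mp h1
        exact ⟨a, b, by linear_combination -ha⟩)
  have e2 := length_quotient_eq_add μ A (A.map μ)
    (Submodule.comap_map_eq_of_injective (fun x y hxy => mul_left_cancel₀ hg hxy) A).symm
  have s1 : A.map μ ⊔ LinearMap.range (param hp).toLinearMap = A := by
    refine sup_eq_right.mpr ?_
    rintro _ ⟨_, ⟨b, rfl⟩, rfl⟩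
    exact ⟨g * b, map_mul (param hp) _ _⟩
  have s2 : A.map μ ⊔ LinearMap.range μ = LinearMap.range μ :=
    sup_eq_right.mpr (LinearMap.map_le_range)
  rw [s1] at e1
  rw [s2, length_quotient_of_order_eq hn.symm] at e2
  rw [intersectionNumber_eq_length, ← hn]
  rw [e1, add_comm] at e2
  exact ENat.add_right_injective_of_ne_top hfin e2

theorem intersectionNumber_eq_order (g : Series K) :
    intersectionNumber p g = (param hp g).order := by
  by_cases hg : param hp g = 0
  · rw [hg, order_zero, ENat.eq_top_iff_forall_ge]
    intro n
    obtain ⟨c, hc⟩ := exists_conductor_exponent hp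
    -- As p divides g, the ideals (p, uⁿg) and (p, g) agree, while (p, uⁿ)₀ = (c+1)n is unbounded.
    -- The exponent c + 1 is positive even when c = 0.
    obtain ⟨u, hu⟩ := hc (X ^ (c + 1)) (pow_dvd_pow _ c.le_succ)
    have h1 : param hp (u ^ n) = X ^ ((c + 1) * n) := by rw [map_pow, hu, pow_mul]
    have h2 : intersectionNumber p (u ^ n) = ((c + 1) * n : ℕ) := by
      rw [intersectionNumber_eq_order_of_ne_zero hp (by rw [h1]; exact pow_ne_zero _ X_ne_zero),
        h1, order_X_pow]
    have h3 : intersectionNumber p (u ^ n) ≤ intersectionNumber p (u ^ n * g) :=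
      intersectionNumber_le_of_dvd (dvd_mul_right _ _)
    have h4 : intersectionNumber p (u ^ n * g) = intersectionNumber p g := by
      rw [param_eq_zero_iff hp] at hg
      have : ∀ h : Series K, p ∣ h → Ideal.span ({p, h} : Set (Series K)) = Ideal.span {p} := by
        intro h hh
        rw [Ideal.span_insert, sup_eq_left, Ideal.span_singleton_le_span_singleton]
        exact hh
      rw [intersectionNumber, intersectionNumber, this _ hg, this _ (hg.mul_left _)]
    rw [← h4]
    refine le_trans ?_ h3
    rw [h2]
    exact_mod_cast Nat.le_mul_of_pos_left n c.succ_pos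
  · exact intersectionNumber_eq_order_of_ne_zero hp hg

theorem intersectionNumber_eq_top_iff {g : Series K} : intersectionNumber p g = ⊤ ↔ p ∣ g := by
  rw [intersectionNumber_eq_order hp, order_eq_top, param_eq_zero_iff]

theorem intersectionNumber_mul (g h : Series K) :
    intersectionNumber p (g * h) = intersectionNumber p g + intersectionNumber p h := by
  simp only [intersectionNumber_eq_order hp, map_mul, order_mul]

theorem intersectionNumber_pow (g : Series K) (n : ℕ) :
    intersectionNumber p (g ^ n) = n * intersectionNumber p g := by
  simp only [intersectionNumber_eq_order hp, map_pow, order_pow, nsmul_eq_mul]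

theorem intersectionNumber_prod {ι : Type*} (s : Finset ι) (g : ι → Series K) :
    intersectionNumber p (∏ i ∈ s, g i) = ∑ i ∈ s, intersectionNumber p (g i) := by
  simp only [intersectionNumber_eq_order hp, map_prod, order_prod]

theorem min_intersectionNumber_le_add (g h : Series K) :
    min (intersectionNumber p g) (intersectionNumber p h) ≤ intersectionNumber p (g + h) := by
  simp only [intersectionNumber_eq_order hp, map_add]
  exact min_order_le_order_add _ _

theorem le_intersectionNumber_sum {ι : Type*} (s : Finset ι) (g : ι → Series K) {n : ℕ∞}
    (h : ∀ i ∈ s, n ≤ intersectionNumber p (g i)) : n ≤ intersectionNumber p (∑ i ∈ s, g i) := by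
  classical
  induction s using Finset.induction_on with
  | empty => rw [Finset.sum_empty, (intersectionNumber_eq_top_iff hp).mpr (dvd_zero p)]; exact le_top
  | insert a s ha ih =>
    rw [Finset.sum_insert ha]
    refine le_trans (le_min (h a (by simp)) (ih fun i hi => h i (by simp [hi])))
      (min_intersectionNumber_le_add hp _ _)

theorem intersectionNumber_eq_zero_iff {g : Series K} :
    intersectionNumber p g = 0 ↔ IsUnit g := by
  constructor
  · intro h
    by_contra hg
    rw [intersectionNumber_eq_length, Module.length_eq_zero_iff] at h
    have h1 : (1 : Series K) ∈ Ideal.span ({p, g} : Set (Series K)) := by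
      have : (1 : Series K) ∈ (Ideal.span ({p, g} : Set (Series K))).restrictScalars K :=
        (Submodule.Quotient.mk_eq_zero _).mp (Subsingleton.elim _ _)
      exact this
    obtain ⟨a, b, hab⟩ := Ideal.mem_span_pair.mp h1
    have hc : ∀ f : Series K, ¬ IsUnit f → MvPowerSeries.constantCoeff f = 0 := by
      intro f hf
      rwa [MvPowerSeries.isUnit_iff_constantCoeff, isUnit_iff_ne_zero, not_not] at hf
    have h2 := congrArg MvPowerSeries.constantCoeff hab
    rw [map_add, map_mul, map_mul, hc p hp.not_isUnit, hc g hg] at h2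
    simp at h2
  · intro h
    rw [intersectionNumber_eq_order hp]
    exact order_zero_of_unit (h.map (param hp))

end Intersection

/-! ### Multiplicity and transversal lines. -/

section Order

variable {K : Type*} [Field K]

theorem le_order_of_X_mul {s : Fin 2} {a : Series K} {n : ℕ}
    (h : ((n + 1 : ℕ) : ℕ∞) ≤ (MvPowerSeries.X s * a).order) : (n : ℕ∞) ≤ a.order := by
  refine MvPowerSeries.nat_le_order fun d hd => ?_
  have h1 : MvPowerSeries.coeff (Finsupp.single s 1 + d) (MvPowerSeries.X s * a) = 0 := by
    refine MvPowerSeries.coeff_of_lt_order (lt_of_lt_of_le ?_ h)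
    rw [map_add, Finsupp.degree_single]
    exact_mod_cast (by omega : 1 + d.degree < n + 1)
  rwa [MvPowerSeries.X, MvPowerSeries.coeff_add_monomial_mul, one_mul] at h1

theorem exists_eq_X_mul_add_X_mul {g : Series K} {n : ℕ} (h : ((n + 1 : ℕ) : ℕ∞) ≤ g.order) :
    ∃ a b : Series K, g = MvPowerSeries.X 0 * a + MvPowerSeries.X 1 * b ∧
      (n : ℕ∞) ≤ a.order ∧ (n : ℕ∞) ≤ b.order := by
  -- The monomials of g involving the first variable; the others are pure powers of the second,
  -- without constant term.
  let g' : Series K := fun m => if m 0 = 0 then 0 else MvPowerSeries.coeff m g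
  have hg' : ∀ m, MvPowerSeries.coeff m g' = if m 0 = 0 then 0 else MvPowerSeries.coeff m g :=
    fun m => rfl
  have h0 : MvPowerSeries.X 0 ∣ g' := by
    rw [MvPowerSeries.X_dvd_iff]
    intro m hm
    rw [hg', if_pos hm]
  have hc : ∀ m : Fin 2 →₀ ℕ, m.degree < n + 1 → MvPowerSeries.coeff m g = 0 := fun m hm =>
    MvPowerSeries.coeff_of_lt_order (lt_of_lt_of_le (by exact_mod_cast hm) h)
  have h1 : MvPowerSeries.X 1 ∣ g - g' := by
    rw [MvPowerSeries.X_dvd_iff]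
    intro m hm
    rw [map_sub, hg']
    split_ifs with hm0
    · rw [sub_zero]
      apply hc
      have : m = 0 := by
        ext i
        fin_cases i
        · exact hm0
        · exact hm
      rw [this]; simp
    · rw [sub_self]
  obtain ⟨a, ha⟩ := h0
  obtain ⟨b, hb⟩ := h1
  refine ⟨a, b, by rw [← ha, ← hb]; ring, le_order_of_X_mul (s := 0) ?_,
    le_order_of_X_mul (s := 1) ?_⟩
  · rw [← ha]
    refine MvPowerSeries.nat_le_order fun d hd => ?_
    rw [hg', hc d hd, ite_self]
  · rw [← hb]
    refine MvPowerSeries.nat_le_order fun d hd => ?_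
    rw [map_sub, hg', hc d hd, ite_self, sub_zero]

theorem isUnit_iff_constantCoeff_ne_zero {g : Series K} :
    IsUnit g ↔ MvPowerSeries.constantCoeff g ≠ 0 := by
  rw [MvPowerSeries.isUnit_iff_constantCoeff, isUnit_iff_ne_zero]

theorem one_le_order_of_not_isUnit {g : Series K} (hg : ¬ IsUnit g) : 1 ≤ g.order := by
  rw [MvPowerSeries.one_le_order_iff_constCoeff_eq_zero]
  rwa [isUnit_iff_constantCoeff_ne_zero, not_not] at hg

theorem irreducible_of_coeff_single_ne_zero {u : Series K}
    (h0 : MvPowerSeries.constantCoeff u = 0) {s : Fin 2}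
    (hs : MvPowerSeries.coeff (Finsupp.single s 1) u ≠ 0) : Irreducible u := by
  refine ⟨fun h => isUnit_iff_constantCoeff_ne_zero.mp h h0, fun a b hab => ?_⟩
  by_contra hcon
  push Not at hcon
  apply hs
  refine MvPowerSeries.coeff_of_lt_order ?_
  have h1 := add_le_add (one_le_order_of_not_isUnit hcon.1) (one_le_order_of_not_isUnit hcon.2)
  rw [Finsupp.degree_single, hab]
  refine lt_of_lt_of_le ?_ (h1.trans MvPowerSeries.le_order_mul)
  norm_num

theorem irreducible_X (s : Fin 2) : Irreducible (MvPowerSeries.X s : Series K) :=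
  irreducible_of_coeff_single_ne_zero (s := s) (by simp) (by simp)

theorem intersectionNumber_X_one_X_zero :
    intersectionNumber (MvPowerSeries.X 1 : Series K) (MvPowerSeries.X 0) = 1 := by
  rw [intersectionNumber_eq_length]
  let f : Series K →ₗ[K] K := MvPowerSeries.coeff 0
  have hf : LinearMap.ker f = (Ideal.span ({MvPowerSeries.X 1, MvPowerSeries.X 0} :
      Set (Series K))).restrictScalars K := by
    ext g
    rw [Submodule.restrictScalars_mem, Ideal.mem_span_pair, LinearMap.mem_ker]
    constructor
    · intro h
      have h1 : ((0 + 1 : ℕ) : ℕ∞) ≤ g.order := by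
        have := MvPowerSeries.one_le_order_iff_constCoeff_eq_zero (f := g)
        exact_mod_cast this.mpr h
      obtain ⟨a, b, hab, -, -⟩ := exists_eq_X_mul_add_X_mul h1
      exact ⟨b, a, by rw [hab]; ring⟩
    · rintro ⟨a, b, rfl⟩
      have h : MvPowerSeries.constantCoeff
          (a * MvPowerSeries.X 1 + b * MvPowerSeries.X 0 : Series K) = 0 := by simp
      exact h
  have hs : Function.Surjective f := fun c => ⟨MvPowerSeries.C c, MvPowerSeries.coeff_zero_C c⟩
  have e := (Submodule.quotEquivOfEq _ _ hf.symm).trans (f.quotKerEquivOfSurjective hs)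
  rw [e.length_eq, Module.length_eq_finrank]
  simp

theorem order_eq_mult {g : Series K} (hg : g ≠ 0) : g.order = mult g := by
  rw [mult]
  exact (MvPowerSeries.ne_zero_iff_order_finite.mp hg).symm

variable [IsAlgClosed K]

theorem mul_order_le_intersectionNumber {p : Series K} (hp : Irreducible p) {M : ℕ∞}
    (h : ∀ s, M ≤ intersectionNumber p (MvPowerSeries.X s)) {n : ℕ} {g : Series K}
    (hg : (n : ℕ∞) ≤ g.order) : n * M ≤ intersectionNumber p g := by
  induction n generalizing g with
  | zero => simp
  | succ n ih =>
    obtain ⟨a, b, rfl, ha, hb⟩ := exists_eq_X_mul_add_X_mul hg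
    refine le_trans (le_min ?_ ?_) (min_intersectionNumber_le_add hp _ _)
    · rw [intersectionNumber_mul hp, Nat.cast_succ, add_mul, one_mul, add_comm]
      exact add_le_add (h 0) (ih ha)
    · rw [intersectionNumber_mul hp, Nat.cast_succ, add_mul, one_mul, add_comm]
      exact add_le_add (h 1) (ih hb)

theorem one_le_intersectionNumber {p g : Series K} (hp : Irreducible p) (hg : ¬ IsUnit g) :
    1 ≤ intersectionNumber p g := by
  rw [Order.one_le_iff_ne_zero, Ne, intersectionNumber_eq_zero_iff hp]
  exact hg

theorem mult_mul_mult_le_intersectionNumber {p g : Series K} (hp : Irreducible p) (hg : g ≠ 0) :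
    (mult g : ℕ∞) * mult p ≤ intersectionNumber p g := by
  refine mul_order_le_intersectionNumber hp (fun s => ?_) (order_eq_mult hg).ge
  rw [intersectionNumber_comm]
  -- The same estimate on a coordinate axis, where both variables have value at least 1, supplies
  -- the bound mult p for the values of the variables along p.
  have := mul_order_le_intersectionNumber (irreducible_X (K := K) s) (M := 1)
    (fun t => one_le_intersectionNumber (irreducible_X s) (irreducible_X t).not_isUnit)
    (order_eq_mult hp.ne_zero).ge
  rwa [mul_one] at this

theorem mult_pos {p : Series K} (hp : Irreducible p) : 0 < mult p := by
  have h1 := one_le_order_of_not_isUnit hp.not_isUnit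
  rw [order_eq_mult hp.ne_zero] at h1
  exact_mod_cast h1

/-- The value at `(c, 1)` of the initial form of `g`. -/
def initialEval (g : Series K) : Polynomial K :=
  ∑ i ∈ Finset.range (mult g + 1), Polynomial.C (MvPowerSeries.coeff
    (Finsupp.single 0 i + Finsupp.single 1 (mult g - i)) g) * Polynomial.X ^ i

theorem eq_single_add_single (d : Fin 2 →₀ ℕ) : d = Finsupp.single 0 (d 0) + Finsupp.single 1 (d 1) := by
  ext i
  fin_cases i <;> simp

theorem degree_eq_add (d : Fin 2 →₀ ℕ) : d.degree = d 0 + d 1 := by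
  rw [Finsupp.degree_eq_sum, Fin.sum_univ_two]

theorem initialEval_ne_zero {g : Series K} (hg : g ≠ 0) : initialEval g ≠ 0 := by
  obtain ⟨d, hd, hdeg⟩ := MvPowerSeries.exists_coeff_ne_zero_and_order
    (MvPowerSeries.ne_zero_iff_order_finite.mp hg)
  rw [order_eq_mult hg, Nat.cast_inj, degree_eq_add] at hdeg
  intro h
  have h1 := congrArg (Polynomial.coeff · (d 0)) h
  simp only [initialEval, Polynomial.finsetSum_coeff, Polynomial.coeff_C_mul, Polynomial.coeff_X_pow,
    Polynomial.coeff_zero] at h1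
  rw [Finset.sum_eq_single (d 0)] at h1
  · rw [if_pos rfl, mul_one, ← hdeg, Nat.add_sub_cancel_left, ← eq_single_add_single] at h1
    exact hd h1
  · intro b _ hb
    rw [if_neg hb.symm, mul_zero]
  · intro hn
    exact absurd (Finset.mem_range.mpr (by omega)) hn

/-- On the line x = c y the initial form of g becomes its value at (c, 1) times y^m, and the
remaining terms have order above m. -/
theorem intersectionNumber_line (c : K) (g : Series K) (hg : g ≠ 0)
    (hc : (initialEval g).eval c ≠ 0) (hu : Irreducible
      (MvPowerSeries.X 0 - MvPowerSeries.C c * MvPowerSeries.X 1 : Series K)) :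
    intersectionNumber (MvPowerSeries.X 0 - MvPowerSeries.C c * MvPowerSeries.X 1) g = mult g := by
  set u : Series K := MvPowerSeries.X 0 - MvPowerSeries.C c * MvPowerSeries.X 1
  set m := mult g
  have hC : ∀ a : K, param hu (MvPowerSeries.C a) = PowerSeries.C a := fun a => (param hu).commutes a
  have hu0 : param hu (MvPowerSeries.X 0) = PowerSeries.C c * param hu (MvPowerSeries.X 1) := by
    have := (param_eq_zero_iff hu).mpr (dvd_refl u)
    rw [map_sub, map_mul, hC, sub_eq_zero] at this
    exact this
  have h1 : intersectionNumber u (MvPowerSeries.X 1) = 1 := by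
    rw [intersectionNumber_comm, ← intersectionNumber_X_one_X_zero (K := K)]
    have := (param_eq_zero_iff (irreducible_X (K := K) 1)).mpr (dvd_refl _)
    rw [intersectionNumber_eq_order (irreducible_X 1), intersectionNumber_eq_order (irreducible_X 1),
      map_sub, map_mul, this, mul_zero, sub_zero]
  have h0 : 1 ≤ intersectionNumber u (MvPowerSeries.X 0) :=
    one_le_intersectionNumber hu (irreducible_X 0).not_isUnit
  let g' : Series K := ∑ i ∈ Finset.range (m + 1), MvPowerSeries.monomial
    (Finsupp.single 0 i + Finsupp.single 1 (m - i))
    (MvPowerSeries.coeff (Finsupp.single 0 i + Finsupp.single 1 (m - i)) g)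
  have hrest : ((m + 1 : ℕ) : ℕ∞) ≤ (g - g').order := by
    refine MvPowerSeries.nat_le_order fun d hd => ?_
    rw [map_sub, map_sum]
    simp only [MvPowerSeries.coeff_monomial]
    rcases (Nat.lt_succ_iff_lt_or_eq.mp hd) with hlt | heq
    · rw [MvPowerSeries.coeff_of_lt_order (by rw [order_eq_mult hg]; exact_mod_cast hlt),
        Finset.sum_eq_zero, sub_zero]
      intro i hi
      rw [if_neg]
      rintro rfl
      rw [degree_eq_add] at hlt
      simp at hlt hi
      omega
    · rw [degree_eq_add] at heq
      have e : d = Finsupp.single 0 (d 0) + Finsupp.single 1 (m - d 0) := by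
        conv_lhs => rw [eq_single_add_single d]
        rw [← heq, Nat.add_sub_cancel_left]
      rw [Finset.sum_eq_single (d 0), if_pos e, ← e, sub_self]
      · intro b _ hb
        rw [if_neg]
        intro h
        apply hb
        rw [h]; simp
      · intro hn
        exact absurd (Finset.mem_range.mpr (by omega)) hn
  have hmain : param hu g' = PowerSeries.C ((initialEval g).eval c) *
      param hu (MvPowerSeries.X 1) ^ m := by
    rw [map_sum, initialEval, Polynomial.eval_finsetSum, map_sum, Finset.sum_mul]
    refine Finset.sum_congr rfl fun i hi => ?_
    have hi' : i ≤ m := Nat.lt_succ_iff.mp (Finset.mem_range.mp hi)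
    have e : ∀ a : K, MvPowerSeries.monomial (Finsupp.single 0 i + Finsupp.single 1 (m - i)) a =
        (MvPowerSeries.C a * MvPowerSeries.X 0 ^ i * MvPowerSeries.X 1 ^ (m - i) : Series K) := by
      intro a
      rw [MvPowerSeries.X_pow_eq, MvPowerSeries.X_pow_eq, ← MvPowerSeries.monomial_zero_eq_C_apply,
        MvPowerSeries.monomial_mul_monomial, MvPowerSeries.monomial_mul_monomial]
      simp
    rw [e, map_mul, map_mul, hC, map_pow, map_pow, hu0]
    simp only [Polynomial.eval_mul, Polynomial.eval_C, Polynomial.eval_pow, Polynomial.eval_X,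
      map_mul, map_pow]
    rw [mul_pow, ← mul_assoc, mul_assoc _ (_ ^ i) (_ ^ (m - i)), ← pow_add, Nat.add_sub_cancel' hi']
  have h2 : (param hu g').order = m := by
    rw [hmain, order_mul, order_pow, ← intersectionNumber_eq_order hu, h1, nsmul_one,
      order_zero_of_unit, zero_add]
    exact (isUnit_iff_ne_zero.mpr hc).map _
  have h3 : ((m + 1 : ℕ) : ℕ∞) ≤ (param hu (g - g')).order := by
    rw [← intersectionNumber_eq_order hu]
    have := mul_order_le_intersectionNumber hu (M := 1) (fun s => by
      fin_cases s
      · exact h0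
      · exact h1.ge) hrest
    rwa [mul_one] at this
  rw [intersectionNumber_eq_order hu, ← sub_add_cancel g g', map_add, order_add_of_order_ne, h2]
  · refine min_eq_right (le_trans ?_ h3)
    exact_mod_cast Nat.le_succ m
  · rw [h2]
    intro h
    rw [h] at h3
    norm_cast at h3
    omega

/-- A generic line is transversal to finitely many given curves. -/
theorem exists_transversal {ι : Type*} (s : Finset ι) (g : ι → Series K) (hg : ∀ i ∈ s, g i ≠ 0) :
    ∃ u : Series K, Irreducible u ∧ ∀ i ∈ s, intersectionNumber u (g i) = mult (g i) := by
  have hP : ∏ i ∈ s, initialEval (g i) ≠ 0 :=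
    Finset.prod_ne_zero_iff.mpr fun i hi => initialEval_ne_zero (hg i hi)
  have : Infinite K := IsAlgClosed.instInfinite
  classical
  obtain ⟨c, hc⟩ := Infinite.exists_notMem_finset (∏ i ∈ s, initialEval (g i)).roots.toFinset
  rw [Multiset.mem_toFinset, Polynomial.mem_roots hP, Polynomial.IsRoot, Polynomial.eval_prod,
    Finset.prod_eq_zero_iff] at hc
  push Not at hc
  have hu : Irreducible (MvPowerSeries.X 0 - MvPowerSeries.C c * MvPowerSeries.X 1 : Series K) := by
    refine irreducible_of_coeff_single_ne_zero (s := 0) (by simp) ?_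
    simp [MvPowerSeries.coeff_index_single_X]
  exact ⟨_, hu, fun i hi => intersectionNumber_line c (g i) (hg i hi) (hc i hi) hu⟩

/-- A line transversal to all factors meets the product in ∑ m(gᵢ), which bounds the multiplicity of
the product from above. -/
theorem mult_prod {ι : Type*} (s : Finset ι) (g : ι → Series K) (hg : ∀ i ∈ s, g i ≠ 0) :
    mult (∏ i ∈ s, g i) = ∑ i ∈ s, mult (g i) := by
  have h0 : ∏ i ∈ s, g i ≠ 0 := Finset.prod_ne_zero_iff.mpr hg
  obtain ⟨u, hu, h⟩ := exists_transversal s g hg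
  apply le_antisymm
  · have h1 := mult_mul_mult_le_intersectionNumber hu h0
    rw [intersectionNumber_prod hu, Finset.sum_congr rfl h] at h1
    have h2 : mult (∏ i ∈ s, g i) * mult u ≤ ∑ i ∈ s, mult (g i) := by exact_mod_cast h1
    exact (Nat.le_mul_of_pos_right _ (mult_pos hu)).trans h2
  · have h1 := MvPowerSeries.le_order_prod g s
    rw [order_eq_mult h0, Finset.sum_congr rfl fun i hi => order_eq_mult (hg i hi)] at h1
    exact_mod_cast h1

end Order

/-! ### Conductor estimates and the strong triangle inequality. -/

section Contact

variable {K : Type*} [Field K] [IsAlgClosed K]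

theorem intersectionNumber_sub_C_mul_gt {p : Series K} (hp : Irreducible p) {g h : Series K}
    {n : ℕ} (hg : intersectionNumber p g = n) (hh : intersectionNumber p h = n) :
    ∃ c : K, ((n + 1 : ℕ) : ℕ∞) ≤ intersectionNumber p (g - MvPowerSeries.C c * h) := by
  rw [intersectionNumber_eq_order hp] at hg hh
  have hg' := order_eq_nat.mp hg
  have hh' := order_eq_nat.mp hh
  refine ⟨coeff n (param hp g) / coeff n (param hp h), ?_⟩
  have hC : ∀ a : K, param hp (MvPowerSeries.C a) = PowerSeries.C a := fun a => (param hp).commutes a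
  rw [intersectionNumber_eq_order hp, map_sub, map_mul, hC]
  refine nat_le_order _ _ fun i hi => ?_
  rw [map_sub, coeff_C_mul]
  rcases Nat.lt_succ_iff_lt_or_eq.mp hi with h1 | rfl
  · rw [hg'.2 i h1, hh'.2 i h1, mul_zero, sub_zero]
  · rw [div_mul_cancel₀ _ hh'.1, sub_self]

/-- An element of small order along `u` has small order along `p`, relative to the conductor. -/
theorem lt_conductor_add {p u h : Series K} (hp : Irreducible p) (hu : Irreducible u) {c m n : ℕ}
    (hc : ∀ z : K⟦X⟧, X ^ c ∣ z → ∃ g, param hp g = z) (hm : intersectionNumber u p = m)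
    (hlt : intersectionNumber u h < m) (hn : (n : ℕ∞) ≤ intersectionNumber p h) : n < c + m := by
  by_contra hcon
  rw [not_lt] at hcon
  have hm' : (param hp u).order = m := by
    rw [← intersectionNumber_eq_order hp, intersectionNumber_comm, hm]
  obtain ⟨e, he, hue⟩ := exists_eq_X_pow_mul_isUnit hm'
  rw [intersectionNumber_eq_order hp] at hn
  -- If n ≥ c + m, then h is congruent modulo p to a multiple u g, the cofactor being in the
  -- conductor. Restricted to u this makes h a multiple of p, so (u,h)₀ ≥ (u,p)₀ = m, against `hlt`.
  have h1 : param hp u * X ^ c ∣ param hp h := by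
    rw [dvd_iff_order_le, order_mul, hm', order_X_pow]
    refine le_trans ?_ hn
    rw [add_comm]
    exact_mod_cast hcon
  obtain ⟨z, hz⟩ := h1
  obtain ⟨g, hg⟩ := hc (X ^ c * z) (dvd_mul_right _ _)
  have h2 : p ∣ h - u * g := by
    rw [← param_eq_zero_iff hp, map_sub, map_mul, hg, hz]; ring
  have h3 : intersectionNumber u p ≤ intersectionNumber u (h - u * g) :=
    intersectionNumber_le_of_dvd h2
  have h4 : intersectionNumber u (h - u * g) = intersectionNumber u h := by
    rw [intersectionNumber_eq_order hu, intersectionNumber_eq_order hu, map_sub, map_mul,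
      (param_eq_zero_iff hu).mpr dvd_rfl, zero_mul, sub_zero]
  rw [h4, hm] at h3
  exact absurd hlt (not_lt.mpr h3)

theorem mul_sub_one_lt_conductor_add {p u w : Series K} (hp : Irreducible p) (hu : Irreducible u)
    {c m β : ℕ} (hc : ∀ z : K⟦X⟧, X ^ c ∣ z → ∃ g, param hp g = z)
    (hm : intersectionNumber u p = m) (hm0 : 0 < m) (hw : intersectionNumber u w = 1)
    (hβ : (β : ℕ∞) ≤ intersectionNumber p w) : (m - 1) * β < c + m := by
  refine lt_conductor_add hp hu hc hm (h := w ^ (m - 1)) ?_ ?_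
  · rw [intersectionNumber_pow hu, hw, mul_one]
    exact_mod_cast Nat.sub_lt hm0 one_pos
  · rw [intersectionNumber_pow hp]
    push_cast
    gcongr

/-- If e = gcd(m, β) > 1, then w^(m/e) and u^(β/e) have the same value along p, and a combination of
them has a larger one. Times a power of w it has value m - 1 along u and at least (m-1)β + 1 = c + m
along p, contradicting `lt_conductor_add`. -/
theorem coprime_of_conductor_eq {p u w : Series K} (hp : Irreducible p) (hu : Irreducible u)
    {c m β : ℕ} (hc : ∀ z : K⟦X⟧, X ^ c ∣ z → ∃ g, param hp g = z)
    (hm : intersectionNumber u p = m) (hm0 : 0 < m) (hw : intersectionNumber u w = 1)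
    (hβ : intersectionNumber p w = β) (hβ0 : 0 < β) (heq : c + m = (m - 1) * β + 1) :
    m.Coprime β := by
  by_contra hcop
  set e := m.gcd β with he
  have he1 : 2 ≤ e := by
    have h0 : 0 < e := Nat.gcd_pos_of_pos_left _ hm0
    have h1 : e ≠ 1 := hcop
    omega
  obtain ⟨m', hm'⟩ := Nat.gcd_dvd_left m β
  obtain ⟨β', hβ'⟩ := Nat.gcd_dvd_right m β
  rw [← he] at hm' hβ'
  have hβ'0 : 0 < β' := Nat.pos_of_ne_zero fun h => by rw [h, mul_zero] at hβ'; omega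
  have hm'0 : 0 < m' := Nat.pos_of_ne_zero fun h => by rw [h, mul_zero] at hm'; omega
  have hm'lt : m' + 1 ≤ m := by rw [hm']; nlinarith
  have hm2 : intersectionNumber p u = m := by rw [intersectionNumber_comm, hm]
  obtain ⟨a, ha⟩ := intersectionNumber_sub_C_mul_gt hp (g := w ^ m') (h := u ^ β') (n := m' * β)
    (by rw [intersectionNumber_pow hp, hβ]; push_cast; rfl)
    (by
      rw [intersectionNumber_pow hp, hm2]
      have : m' * β = β' * m := by
        conv_lhs => rw [hβ']
        conv_rhs => rw [hm']
        ring
      rw [this]; push_cast; rfl)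
  have h1 := lt_conductor_add hp hu hc hm (n := (m - 1) * β + 1)
    (h := (w ^ m' - MvPowerSeries.C a * u ^ β') * w ^ (m - 1 - m')) (by
      have e1 : intersectionNumber u (w ^ m' - MvPowerSeries.C a * u ^ β') = m' := by
        have : intersectionNumber u (w ^ m') = m' := by
          rw [intersectionNumber_pow hu, hw, mul_one]
        rw [← this, intersectionNumber_eq_order hu, intersectionNumber_eq_order hu, map_sub, map_mul,
          map_pow (param hu) u, (param_eq_zero_iff hu).mpr dvd_rfl, zero_pow hβ'0.ne', mul_zero,
          sub_zero]
      rw [intersectionNumber_mul hu, e1, intersectionNumber_pow hu, hw, mul_one]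
      exact_mod_cast (by omega : m' + (m - 1 - m') < m)) (by
      rw [intersectionNumber_mul hp, intersectionNumber_pow hp, hβ]
      have e2 : (m - 1) * β + 1 = (m' * β + 1) + (m - 1 - m') * β := by
        have : m - 1 = m' + (m - 1 - m') := by omega
        conv_lhs => rw [this]
        ring
      rw [e2]
      push_cast
      refine add_le_add ?_ le_rfl
      exact_mod_cast ha)
  omega

/-- Substitution of a nonunit for the variable of a power series. -/
def substHom {u : Series K} (hu : Irreducible u) : K⟦X⟧ →ₐ[K] Series K :=
  PowerSeries.substAlgHom (PowerSeries.HasSubst.of_constantCoeff_zero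
    (by_contra fun h => hu.not_isUnit (isUnit_iff_constantCoeff_ne_zero.mpr h)))

theorem substHom_X {u : Series K} (hu : Irreducible u) : substHom hu X = u :=
  PowerSeries.substAlgHom_X _

theorem order_mul_le_substHom {p u : Series K} (hp : Irreducible p) (hu : Irreducible u) {n : ℕ}
    {a : K⟦X⟧} (ha : (n : ℕ∞) ≤ a.order) :
    n * intersectionNumber p u ≤ intersectionNumber p (substHom hu a) := by
  rw [← X_pow_dvd_iff_le_order] at ha
  obtain ⟨b, rfl⟩ := ha
  rw [map_mul, map_pow, substHom_X, intersectionNumber_mul hp, intersectionNumber_pow hp]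
  exact le_self_add

theorem substHom_mod {u : Series K} (hu : Irreducible u) (a : K⟦X⟧) :
    param hu (substHom hu a) = PowerSeries.C (constantCoeff a) := by
  have h1 : X ∣ a - PowerSeries.C (constantCoeff a) := by rw [X_dvd_iff]; simp
  obtain ⟨b, hb⟩ := h1
  have h2 : param hu (substHom hu X) = 0 := by rw [substHom_X]; exact (param_eq_zero_iff hu).mpr dvd_rfl
  have h3 : ∀ c : K, param hu (substHom hu (PowerSeries.C c)) = PowerSeries.C c := fun c =>
    ((param hu).comp (substHom hu)).commutes c
  have h4 := congrArg (fun z => param hu (substHom hu z)) hb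
  simp only [map_sub, map_mul, h2, h3, zero_mul] at h4
  exact sub_eq_zero.mp h4

/-- A form of the strong triangle inequality for the order of contact. -/
theorem min_le_intersectionNumber {p q u w : Series K} (hp : Irreducible p) (hq : Irreducible q)
    (hu : Irreducible u) {m β n : ℕ} (hm : intersectionNumber q u = m) (hm0 : 0 < m)
    (hw : intersectionNumber u w = 1) (hβ0 : 0 < β) (hβ : (β : ℕ∞) ≤ intersectionNumber q w)
    (hn : intersectionNumber p u = n) :
    min ((n * β : ℕ) : ℕ∞) (m * intersectionNumber p w) ≤ intersectionNumber p q := by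
  let θ : K⟦X⟧ →ₐ[K] K⟦X⟧ := (param hq).comp (substHom hu)
  have hθ : (θ X).order = m := by
    change (param hq (substHom hu X)).order = m
    rw [substHom_X, ← intersectionNumber_eq_order hq, hm]
  have hdec := fun j : Fin m => exists_decomposition θ hm0 hθ (param hq w * X ^ (j : ℕ))
  choose M hM hMo using hdec
  have hMo' : ∀ (j i : Fin m), ((β + j : ℕ) : ℕ∞) ≤ m * (M j i).order + (i : ℕ) := by
    intro j i
    refine le_trans ?_ (hMo j i)
    rw [order_mul, order_X_pow, ← intersectionNumber_eq_order hq]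
    push_cast
    gcongr
  -- M is the matrix of multiplication by w on 1, X, …, X^(m-1) over series in u along q. So B = w -
  -- M kills the vector (Xⁱ) along q, and its determinant is a Cayley–Hamilton equation divisible by
  -- q.
  let B : Matrix (Fin m) (Fin m) (Series K) := fun j i =>
    (if j = i then w else 0) - substHom hu (M j i)
  have hB : ∀ j i, B j i = (if j = i then w else 0) - substHom hu (M j i) := fun j i => rfl
  have hq_dvd : q ∣ B.det := by
    rw [← param_eq_zero_iff hq]
    have h1 : param hq B.det = (B.map (param hq)).det := AlgHom.map_det _ _
    rw [h1, ← Matrix.exists_mulVec_eq_zero_iff]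
    refine ⟨fun i => X ^ (i : ℕ), ?_, ?_⟩
    · intro h
      exact pow_ne_zero _ X_ne_zero (congrFun h ⟨0, hm0⟩)
    · funext j
      simp only [Matrix.mulVec, dotProduct, Matrix.map_apply, hB, map_sub, sub_mul,
        Finset.sum_sub_distrib, Pi.zero_apply]
      rw [sub_eq_zero, Finset.sum_eq_single j]
      · rw [if_pos rfl, hM j]; rfl
      · intro i _ hi
        rw [if_neg hi.symm, map_zero, zero_mul]
      · simp
  -- Because β > 0, the entries of M with i ≤ j have no constant term; modulo u the matrix is
  -- triangular with w on the diagonal. Hence det B has the same value m along u as q, and the two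
  -- differ by a unit.
  have hu_det : intersectionNumber u B.det = m := by
    rw [intersectionNumber_eq_order hu]
    have h1 : param hu B.det = (B.map (param hu)).det := AlgHom.map_det _ _
    have h2 : ∀ j i : Fin m, i ≤ j → param hu (substHom hu (M j i)) = 0 := by
      intro j i hij
      rw [substHom_mod]
      have h3 : constantCoeff (M j i) = 0 := by
        rw [← X_dvd_iff, ← pow_one X, X_pow_dvd_iff_le_order]
        by_contra hcon
        rw [not_le, Nat.cast_one, Order.lt_one_iff] at hcon
        have h4 := hMo' j i
        rw [hcon, mul_zero, zero_add] at h4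
        have h5 : β + j ≤ (i : ℕ) := by exact_mod_cast h4
        have h6 : (i : ℕ) ≤ j := hij
        omega
      rw [h3, map_zero]
    rw [h1, Matrix.det_of_isUpperTriangular]
    · rw [order_prod, Finset.sum_eq_card_nsmul (b := 1)]
      · simp
      · intro i _
        rw [Matrix.map_apply, hB, if_pos rfl, map_sub, h2 i i le_rfl, sub_zero, ← intersectionNumber_eq_order hu, hw]
    · intro j i hij
      have hij' : i < j := hij
      rw [Matrix.map_apply, hB, if_neg hij'.ne', zero_sub, map_neg, h2 j i hij'.le, neg_zero]
  obtain ⟨h, hh⟩ := hq_dvd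
  have hunit : IsUnit h := by
    rw [← intersectionNumber_eq_zero_iff hu]
    rw [hh, intersectionNumber_mul hu, intersectionNumber_comm u q, hm] at hu_det
    exact ENat.add_right_injective_of_ne_top (ENat.natCast_ne_top m) (hu_det.trans (add_zero _).symm)
  have hpq : intersectionNumber p q = intersectionNumber p B.det := by
    rw [hh, intersectionNumber_mul hp, (intersectionNumber_eq_zero_iff hp).mpr hunit, add_zero]
  rw [hpq]
  set s := min ((n * β : ℕ) : ℕ∞) (m * intersectionNumber p w) with hs
  -- The weights n j and n i reflect the position of the entry; in each product of the determinant
  -- expansion they cancel, leaving m s ≤ m times its value along p.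
  have hentry : ∀ j i : Fin m, s + (n * (j : ℕ) : ℕ) ≤ m * intersectionNumber p (B j i) + (n * (i : ℕ) : ℕ) := by
    intro j i
    have hsub : s + (n * (j : ℕ) : ℕ) ≤ m * intersectionNumber p (substHom hu (M j i)) + (n * (i : ℕ) : ℕ) := by
      rcases eq_or_ne (M j i).order ⊤ with htop | htop
      · rw [order_eq_top] at htop
        rw [htop, map_zero, (intersectionNumber_eq_top_iff hp).mpr (dvd_zero p),
          ENat.mul_top (by exact_mod_cast hm0.ne')]
        simp
      · obtain ⟨k, hk⟩ := ENat.ne_top_iff_exists.mp htop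
        have h1 := order_mul_le_substHom hp hu hk.le
        rw [hn] at h1
        have h2 := hMo' j i
        rw [← hk] at h2
        have h3 : β + j ≤ m * k + i := by exact_mod_cast h2
        calc s + (n * (j : ℕ) : ℕ) ≤ (n * β : ℕ) + (n * (j : ℕ) : ℕ) := by gcongr; exact min_le_left _ _
          _ ≤ ((m * (k * n) : ℕ) : ℕ∞) + (n * (i : ℕ) : ℕ) := by
            norm_cast
            nlinarith
          _ ≤ _ := by
            push_cast
            gcongr
    have hdiag : j = i → s + (n * (j : ℕ) : ℕ) ≤ m * intersectionNumber p w + (n * (i : ℕ) : ℕ) := by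
      rintro rfl
      gcongr
      exact min_le_right _ _
    rw [hB, sub_eq_add_neg]
    have hneg : intersectionNumber p (-substHom hu (M j i)) = intersectionNumber p (substHom hu (M j i)) := by
      rw [intersectionNumber_eq_order hp, intersectionNumber_eq_order hp, map_neg, order_neg]
    have hmin := min_intersectionNumber_le_add hp (if j = i then w else 0) (-substHom hu (M j i))
    rw [hneg] at hmin
    refine le_trans ?_ (add_le_add (mul_le_mul_right hmin _) le_rfl)
    rcases min_choice (intersectionNumber p (if j = i then w else 0))
      (intersectionNumber p (substHom hu (M j i))) with h1 | h1
    · rw [h1]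
      split_ifs with hij
      · exact hdiag hij
      · rw [(intersectionNumber_eq_top_iff hp).mpr (dvd_zero p),
          ENat.mul_top (by exact_mod_cast hm0.ne')]
        simp
    · rw [h1]; exact hsub
  rw [Matrix.det_apply]
  refine le_intersectionNumber_sum hp _ _ fun σ _ => ?_
  have hsign : intersectionNumber p (Equiv.Perm.sign σ • ∏ i, B (σ i) i) =
      intersectionNumber p (∏ i, B (σ i) i) := by
    rcases Int.units_eq_one_or (Equiv.Perm.sign σ) with h1 | h1
    · rw [h1, one_smul]
    · rw [h1, Units.neg_smul, one_smul, intersectionNumber_eq_order hp, intersectionNumber_eq_order hp, map_neg, order_neg]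
  rw [hsign, intersectionNumber_prod hp]
  have hsum := Finset.sum_le_sum fun (i : Fin m) (_ : i ∈ Finset.univ) => hentry (σ i) i
  rw [Finset.sum_add_distrib, Finset.sum_add_distrib, ← Finset.mul_sum,
    Equiv.sum_comp σ (fun i : Fin m => ((n * (i : ℕ) : ℕ) : ℕ∞)), Finset.sum_const, Finset.card_univ,
    Fintype.card_fin, nsmul_eq_mul] at hsum
  have hfin : (∑ i : Fin m, ((n * (i : ℕ) : ℕ) : ℕ∞)) ≠ ⊤ := by
    rw [← Nat.cast_sum]; exact ENat.natCast_ne_top _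
  have h2 := (ENat.add_le_add_iff_right hfin).mp hsum
  exact (ENat.mul_le_mul_left_iff (by exact_mod_cast hm0.ne') (ENat.natCast_ne_top m)).mp h2

end Contact

/-! ### Conductor exponent and semigroup of a branch. -/

section Conductor

variable {K : Type*} [Field K] [IsAlgClosed K]

open Classical in
/-- The exponent of the conductor of a branch. -/
def conductorExponent {p : Series K} (hp : Irreducible p) : ℕ := Nat.find (exists_conductor_exponent hp)

theorem conductorExponent_spec {p : Series K} (hp : Irreducible p) (z : K⟦X⟧)
    (hz : X ^ conductorExponent hp ∣ z) : ∃ g, param hp g = z := by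
  classical
  exact Nat.find_spec (exists_conductor_exponent hp) z hz

theorem conductorExponent_le {p : Series K} (hp : Irreducible p) {c : ℕ}
    (hc : ∀ z : K⟦X⟧, X ^ c ∣ z → ∃ g, param hp g = z) : conductorExponent hp ≤ c := by
  classical
  exact Nat.find_min' (exists_conductor_exponent hp) hc

theorem mem_semigroup_iff {p : Series K} (hp : Irreducible p) {n : ℕ} :
    n ∈ semigroup p ↔ ∃ g, intersectionNumber p g = n := by
  refine ⟨fun ⟨g, _, hg⟩ => ⟨g, hg⟩, fun ⟨g, hg⟩ => ⟨g, fun hd => ?_, hg⟩⟩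
  rw [(intersectionNumber_eq_top_iff hp).mpr hd] at hg
  exact ENat.natCast_ne_top n hg.symm

theorem zero_mem_semigroup {p : Series K} (hp : Irreducible p) : 0 ∈ semigroup p :=
  (mem_semigroup_iff hp).mpr ⟨1, by
    rw [(intersectionNumber_eq_zero_iff hp).mpr isUnit_one, Nat.cast_zero]⟩

theorem add_mem_semigroup {p : Series K} (hp : Irreducible p) {a b : ℕ} (ha : a ∈ semigroup p)
    (hb : b ∈ semigroup p) : a + b ∈ semigroup p := by
  rw [mem_semigroup_iff hp] at *
  obtain ⟨g, hg⟩ := ha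
  obtain ⟨h, hh⟩ := hb
  exact ⟨g * h, by rw [intersectionNumber_mul hp, hg, hh, Nat.cast_add]⟩

theorem mem_semigroup_of_le {p : Series K} (hp : Irreducible p) {n : ℕ}
    (hn : conductorExponent hp ≤ n) : n ∈ semigroup p := by
  obtain ⟨g, hg⟩ := conductorExponent_spec hp (X ^ n) (pow_dvd_pow _ hn)
  exact (mem_semigroup_iff hp).mpr ⟨g, by rw [intersectionNumber_eq_order hp, hg, order_X_pow]⟩

/-- If c - 1 were a value, subtracting a scalar multiple of an element attaining it would push any
series of order c - 1 into the conductor, against minimality of c. -/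
theorem notMem_semigroup_of_succ_eq {p : Series K} (hp : Irreducible p) {n : ℕ}
    (hn : n + 1 = conductorExponent hp) : n ∉ semigroup p := by
  intro hmem
  obtain ⟨g, hg⟩ := (mem_semigroup_iff hp).mp hmem
  have h1 := conductorExponent_le hp (c := n) fun z hz => by
    rw [intersectionNumber_eq_order hp] at hg
    have hC : ∀ a : K, param hp (MvPowerSeries.C a) = PowerSeries.C a :=
      fun a => (param hp).commutes a
    obtain ⟨h, hh⟩ := conductorExponent_spec hp
      (z - PowerSeries.C (coeff n z / coeff n (param hp g)) * param hp g) (by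
        rw [← hn, X_pow_dvd_iff]
        intro i hi
        have hg' := order_eq_nat.mp hg
        rw [map_sub, coeff_C_mul]
        rcases Nat.lt_succ_iff_lt_or_eq.mp hi with h1 | rfl
        · rw [hg'.2 i h1, X_pow_dvd_iff.mp hz i h1, mul_zero, sub_zero]
        · rw [div_mul_cancel₀ _ hg'.1, sub_self])
    refine ⟨h + MvPowerSeries.C (coeff n z / coeff n (param hp g)) * g, ?_⟩
    rw [map_add, map_mul, hC, hh, sub_add_cancel]
  omega

/-- A numerical semigroup containing coprime `m, b` whose Frobenius number is that of `⟨m, b⟩`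
equals `⟨m, b⟩`. -/
theorem mem_iff_of_frobenius {S : Set ℕ} (h0 : 0 ∈ S) (hadd : ∀ a ∈ S, ∀ b ∈ S, a + b ∈ S)
    {m b : ℕ} (hm : m ∈ S) (hb : b ∈ S) (hcop : m.Coprime b) {n₀ : ℕ}
    (hn₀ : n₀ + m + b = m * b) (hm0 : 0 < m) (hmem : n₀ ∉ S) (n : ℕ) :
    n ∈ S ↔ ∃ i j : ℕ, n = i * m + j * b := by
  have hmul : ∀ a ∈ S, ∀ i : ℕ, i * a ∈ S := by
    intro a ha i
    induction i with
    | zero => rwa [zero_mul]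
    | succ i ih => rw [add_mul, one_mul]; exact hadd _ ih _ ha
  constructor
  · intro hn
    obtain ⟨j, hj, hjn⟩ : ∃ j, j < m ∧ j * b ≡ n [MOD m] := by
      obtain ⟨y, hy⟩ := Nat.exists_mul_mod_eq_of_coprime n hcop.symm hm0.ne'
      refine ⟨y % m, Nat.mod_lt _ hm0, ?_⟩
      have h1 : y % m * b ≡ y * b [MOD m] := (Nat.mod_modEq y m).mul_right b
      rw [mul_comm y b] at h1
      exact h1.trans (by rw [Nat.ModEq, hy.2])
    rcases le_total (j * b) n with hle | hle
    · obtain ⟨i, hi⟩ := (Nat.modEq_iff_dvd' hle).mp hjn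
      exact ⟨i, j, by rw [mul_comm i m]; omega⟩
    · obtain ⟨k, hk⟩ := (Nat.modEq_iff_dvd' hle).mp hjn.symm
      rcases Nat.eq_zero_or_pos k with rfl | hkpos
      · exact ⟨0, j, by omega⟩
      -- Here n = j b - k m with k > 0, and n₀ = (m-1-j) b + n + (k-1) m would lie in S.
      · exfalso
        apply hmem
        obtain ⟨k, rfl⟩ : ∃ k', k = k' + 1 := ⟨k - 1, by omega⟩
        obtain ⟨l, rfl⟩ : ∃ l, m = j + 1 + l := ⟨m - j - 1, by omega⟩
        have e : n₀ = l * b + (n + k * (j + 1 + l)) := by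
          have h2 : j * b = n + (j + 1 + l) * (k + 1) := by omega
          nlinarith
        rw [e]
        exact hadd _ (hmul _ hb _) _ (hadd _ hn _ (hmul _ hm _))
  · rintro ⟨i, j, rfl⟩
    exact hadd _ (hmul _ hm i) _ (hmul _ hb j)

end Conductor

/-- The first n i coefficients on the i-th factor identify the quotient by the conductor with the
product of the spaces K^(n i). -/
theorem conductorDegree_eq_of_linearMap {K : Type*} [Field K] {ι : Type*} [Fintype ι]
    (f : Series K) (β : Normalization f →ₗ[K] (ι → K⟦X⟧)) (hβs : Function.Surjective β) (n : ι → ℕ)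
    (hcond : ∀ a, a ∈ conductor f ↔ ∀ i, X ^ n i ∣ β a i) :
    conductorDegree f = ((∑ i, n i : ℕ) : ℕ∞) := by
  let T : (ι → K⟦X⟧) →ₗ[K] (∀ i, Fin (n i) → K) :=
    LinearMap.pi fun i => LinearMap.pi fun j => (coeff (j : ℕ)).comp (LinearMap.proj i)
  have hT : Function.Surjective T := by
    intro v
    refine ⟨fun i => PowerSeries.mk fun j => if hj : j < n i then v i ⟨j, hj⟩ else 0, ?_⟩
    funext i j
    simp [T]
  have hker : LinearMap.ker (T ∘ₗ β) = (conductor f).restrictScalars K := by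
    ext a
    rw [Submodule.restrictScalars_mem, hcond, LinearMap.mem_ker]
    constructor
    · intro h i
      rw [X_pow_dvd_iff]
      intro j hj
      exact congrFun (congrFun h i) ⟨j, hj⟩
    · intro h
      funext i j
      exact X_pow_dvd_iff.mp (h i) j j.2
  have e := ((Submodule.Quotient.restrictScalarsEquiv K (conductor f)).symm.trans
    (Submodule.quotEquivOfEq _ _ hker.symm)).trans
    ((T ∘ₗ β).quotKerEquivOfSurjective (hT.comp hβs))
  rw [conductorDegree, ← Module.length_eq_rank, e.length_eq, Module.length_eq_finrank,
    Module.finrank_pi_fintype]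
  simp

/-! ### The local ring of a reduced curve inside a product of power series rings. -/

section Normalization

variable {K : Type*} [Field K] [IsAlgClosed K] {ι : Type*} [Fintype ι] [DecidableEq ι]
  {p : ι → Series K} (hp : ∀ i, Irreducible (p i)) (hdist : ∀ i j, i ≠ j → ¬ p i ∣ p j)

include hp hdist

theorem prod_dvd_of_forall_dvd (s : Finset ι) {g : Series K} (h : ∀ i ∈ s, p i ∣ g) :
    ∏ i ∈ s, p i ∣ g := by
  induction s using Finset.induction_on generalizing g with
  | empty => simp
  | insert a s ha ih =>
    obtain ⟨q, rfl⟩ := ih fun i hi => h i (Finset.mem_insert_of_mem hi)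
    rw [Finset.prod_insert ha, mul_comm]
    refine mul_dvd_mul_left _ ?_
    have hpr := prime_of_irreducible (hp a)
    rcases hpr.dvd_or_dvd (h a (Finset.mem_insert_self a s)) with h1 | h1
    · obtain ⟨i, hi, hi'⟩ := (hpr.dvd_finsetProd_iff _).mp h1
      exact absurd hi' (hdist a i (by rintro rfl; exact ha hi))
    · exact h1

/-- The exponent of the conductor along the `i`-th branch of a reduced curve. -/
theorem forall_exists_param_iff (n : ι → ℕ) (hn : ∀ i, (n i : ℕ∞) = conductorExponent (hp i) +
    ∑ j ∈ Finset.univ.erase i, intersectionNumber (p i) (p j)) (v : ι → K⟦X⟧) :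
    (∀ b : ι → K⟦X⟧, ∃ g, ∀ i, param (hp i) g = v i * b i) ↔ ∀ i, X ^ n i ∣ v i := by
  -- G i vanishes on every branch except the i-th, where its order is the sum of the intersection
  -- numbers.
  let G : ι → Series K := fun i => ∏ j ∈ Finset.univ.erase i, p j
  have hG : ∀ i, (n i : ℕ∞) = conductorExponent (hp i) + (param (hp i) (G i)).order := by
    intro i
    rw [hn, ← intersectionNumber_eq_order, intersectionNumber_prod (hp i)]
  have hG0 : ∀ i j, i ≠ j → param (hp i) (G j) = 0 := by
    intro i j hij
    rw [param_eq_zero_iff]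
    exact Finset.dvd_prod_of_mem p (Finset.mem_erase.mpr ⟨hij, Finset.mem_univ i⟩)
  constructor
  · intro h i
    -- Testing on tuples supported at i: a preimage vanishes on the other branches, hence is a
    -- multiple of G i. After dividing by G i, every multiple of v i / G i lies in the image of the
    -- i-th parametrization, so its order is at least the conductor exponent.
    have h1 : ∀ z : K⟦X⟧, ∃ g, v i * z = param (hp i) (G i) * param (hp i) g := by
      intro z
      obtain ⟨g, hg⟩ := h (Pi.single i z)
      have h2 : G i ∣ g := by
        refine prod_dvd_of_forall_dvd hp hdist _ fun j hj => ?_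
        rw [← param_eq_zero_iff (hp j), hg, Pi.single_eq_of_ne (Finset.ne_of_mem_erase hj), mul_zero]
      obtain ⟨q, rfl⟩ := h2
      refine ⟨q, ?_⟩
      have := hg i
      rw [Pi.single_eq_same, map_mul] at this
      exact this.symm
    obtain ⟨g₁, hg₁⟩ := h1 1
    rw [mul_one] at hg₁
    rw [hg₁, X_pow_dvd_iff_le_order, hG, order_mul, add_comm]
    refine add_le_add le_rfl ?_
    rcases eq_or_ne (param (hp i) g₁).order ⊤ with htop | htop
    · rw [htop]; exact le_top
    · obtain ⟨l, hl⟩ := ENat.ne_top_iff_exists.mp htop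
      rw [← hl, Nat.cast_le]
      refine conductorExponent_le (hp i) fun z hz => ?_
      have hd : param (hp i) g₁ ∣ z := by
        rw [dvd_iff_order_le, ← hl, ← X_pow_dvd_iff_le_order]; exact hz
      obtain ⟨y, rfl⟩ := hd
      obtain ⟨q, hq⟩ := h1 y
      refine ⟨q, mul_left_cancel₀ (a := param (hp i) (G i)) ?_ ?_⟩
      · intro h0
        have h3 := hG i
        rw [h0, order_zero, add_top] at h3
        exact ENat.natCast_ne_top _ h3
      · rw [← hq, hg₁, mul_assoc]
  · intro h b
    have h1 : ∀ i, ∃ g, param (hp i) (G i * g) = v i * b i := by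
      intro i
      have hd : param (hp i) (G i) * X ^ conductorExponent (hp i) ∣ v i * b i := by
        refine Dvd.dvd.mul_right ?_ _
        rw [dvd_iff_order_le, order_mul, order_X_pow, add_comm, ← hG, ← X_pow_dvd_iff_le_order]
        exact h i
      obtain ⟨y, hy⟩ := hd
      obtain ⟨g, hg⟩ := conductorExponent_spec (hp i) (X ^ conductorExponent (hp i) * y)
        (dvd_mul_right _ _)
      exact ⟨g, by rw [map_mul, hg, hy, mul_assoc]⟩
    choose g hg using h1
    refine ⟨∑ i, G i * g i, fun i => ?_⟩
    rw [map_sum, Finset.sum_eq_single i]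
    · exact hg i
    · intro j _ hj
      rw [map_mul, hG0 i j hj.symm, zero_mul]
    · simp

theorem prod_dvd_iff {g : Series K} : ∏ i, p i ∣ g ↔ ∀ i, param (hp i) g = 0 := by
  simp only [param_eq_zero_iff]
  exact ⟨fun h i => (Finset.dvd_prod_of_mem p (Finset.mem_univ i)).trans h,
    fun h => prod_dvd_of_forall_dvd hp hdist _ fun i _ => h i⟩

/-- The embedding of the local ring of a reduced curve in the product of power series rings. -/
theorem exists_localRing_hom : ∃ φ : LocalRing (∏ i, p i) →ₐ[K] (ι → K⟦X⟧), Function.Injective φ ∧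
    ∀ g i, φ (Ideal.Quotient.mk _ g) i = param (hp i) g := by
  refine ⟨Ideal.Quotient.liftₐ _ (AlgHom.pi fun i => param (hp i)) ?_, ?_, ?_⟩
  · intro g hg
    rw [Ideal.mem_span_singleton, prod_dvd_iff hp hdist] at hg
    exact funext hg
  · rw [injective_iff_map_eq_zero]
    intro a ha
    obtain ⟨g, rfl⟩ := Ideal.Quotient.mk_surjective a
    rw [Ideal.Quotient.eq_zero_iff_mem, Ideal.mem_span_singleton, prod_dvd_iff hp hdist]
    exact fun i => congrFun ha i
  · exact fun g i => rfl

end Normalization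

/-! ### Identification of the normalization with the product. -/

section Transfer

variable {K : Type*} [Field K] {ι : Type*} [Fintype ι]
  {A : Type*} [CommRing A] [Algebra K A]

/-- Split b into its constant terms, integral over K because K^ι is finite over K, and a tuple
divisible by X, whose (N+1)-st power lies in the image of A. -/
theorem isIntegralElem_of_forall_exists (φ : A →ₐ[K] (ι → K⟦X⟧)) (N : ℕ)
    (hN : ∀ b : ι → K⟦X⟧, ∃ a, φ a = fun i => X ^ N * b i) (b : ι → K⟦X⟧) :
    (φ : A →+* (ι → K⟦X⟧)).IsIntegralElem b := by
  let _ : Algebra A (ι → K⟦X⟧) := (φ : A →+* (ι → K⟦X⟧)).toAlgebra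
  have key : ∀ b : ι → K⟦X⟧, IsIntegral A b := by
    intro b
    have h1 : ∀ i, ∃ y, b i = PowerSeries.C (constantCoeff (b i)) + X * y := by
      intro i
      have h2 : X ∣ b i - PowerSeries.C (constantCoeff (b i)) := by rw [X_dvd_iff]; simp
      obtain ⟨y, hy⟩ := h2
      exact ⟨y, by rw [← hy]; ring⟩
    choose y hy using h1
    let κ : (ι → K) →ₐ[K] (ι → K⟦X⟧) :=
      AlgHom.pi fun i => (Algebra.ofId K K⟦X⟧).comp (Pi.evalAlgHom K (fun _ => K) i)
    have hb : b = κ (fun i => constantCoeff (b i)) + fun i => X * y i := funext hy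
    rw [hb]
    refine IsIntegral.add ?_ ?_
    · have h3 : IsIntegral K (κ fun i => constantCoeff (b i)) :=
        (Algebra.IsIntegral.isIntegral (R := K) (fun i => constantCoeff (b i))).map κ
      exact IsIntegral.map_of_comp_eq (algebraMap K A) (RingHom.id _) (RingHom.ext φ.commutes) h3
    · refine IsIntegral.of_pow (n := N + 1) N.succ_pos ?_
      obtain ⟨a, ha⟩ := hN fun i => X * y i ^ (N + 1)
      have h4 : (fun i => X * y i) ^ (N + 1) = algebraMap A (ι → K⟦X⟧) a := by
        refine Eq.trans ?_ ha.symm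
        funext i
        rw [Pi.pow_apply, mul_pow, pow_succ X, mul_assoc]
      rw [h4]
      exact isIntegral_algebraMap
  exact key b

/-- A subring of a product of power series rings containing a power of the maximal ideal has the
product as its normalization. -/
theorem exists_integralClosure_linearMap (φ : A →ₐ[K] (ι → K⟦X⟧)) (hφ : Function.Injective φ) (N : ℕ)
    (hN : ∀ b : ι → K⟦X⟧, ∃ a, φ a = fun i => X ^ N * b i) :
    ∃ β : integralClosure A (FractionRing A) →ₗ[K] (ι → K⟦X⟧), Function.Bijective β ∧
      (∀ a b, β (a * b) = β a * β b) ∧ ∀ a, β (algebraMap A _ a) = φ a := by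
  let T := ι → FractionRing K⟦X⟧
  let j : (ι → K⟦X⟧) →+* T := RingHom.pi fun i => (algebraMap K⟦X⟧ _).comp (Pi.evalRingHom _ i)
  have hj : Function.Injective j := by
    intro x y hxy
    funext i
    exact IsFractionRing.injective K⟦X⟧ (FractionRing K⟦X⟧) (congrFun hxy i)
  -- If the i-th component of φ(a) vanished, a preimage of X^N at place i and 0 elsewhere would be
  -- annihilated by a.
  have hreg : ∀ a : nonZeroDivisors A, IsUnit ((j.comp (φ : A →+* (ι → K⟦X⟧))) a) := by
    rintro ⟨a, ha⟩
    rw [Pi.isUnit_iff]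
    intro i
    rw [isUnit_iff_ne_zero]
    intro h0
    have h1 : φ a i = 0 := IsFractionRing.injective K⟦X⟧ (FractionRing K⟦X⟧) (h0.trans (map_zero _).symm)
    classical
    obtain ⟨b, hb⟩ := hN (Pi.single i 1)
    have h2 : b * a = 0 := by
      apply hφ
      rw [map_mul, hb, map_zero]
      funext k
      by_cases hk : k = i
      · subst hk; simp [h1]
      · simp [Pi.single_eq_of_ne hk]
    have h3 : b = 0 := (mul_right_mem_nonZeroDivisors_eq_zero_iff ha).mp h2
    rw [h3, map_zero] at hb
    have h4 := congrFun hb i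
    rw [Pi.single_eq_same, mul_one] at h4
    exact pow_ne_zero N X_ne_zero h4.symm
  let Ψ : FractionRing A →+* T := IsLocalization.lift hreg
  have hΨ : ∀ a : A, Ψ (algebraMap A _ a) = j (φ a) := fun a => IsLocalization.lift_eq hreg a
  have hΨi : Function.Injective Ψ := by
    refine (IsLocalization.lift_injective_iff hreg).mpr fun x y => ?_
    rw [(IsFractionRing.injective A (FractionRing A)).eq_iff]
    exact (hj.comp hφ).eq_iff.symm
  have hint : ∀ z : integralClosure A (FractionRing A), ∃ b, j b = Ψ z := by
    intro z
    have h1 : ∀ i, ∃ b, algebraMap K⟦X⟧ (FractionRing K⟦X⟧) b = Ψ z i := by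
      intro i
      apply IsIntegrallyClosed.isIntegral_iff.mp
      refine IsIntegral.map_of_comp_eq ((Pi.evalRingHom _ i).comp (φ : A →+* (ι → K⟦X⟧)))
        ((Pi.evalRingHom _ i).comp Ψ) ?_ z.2
      ext a
      exact (congrFun (hΨ a) i).symm
    choose b hb using h1
    exact ⟨b, funext hb⟩
  choose β hβ using hint
  have hsmul : ∀ (c : K) (b : ι → K⟦X⟧), c • b = algebraMap K (ι → K⟦X⟧) c * b := fun c b =>
    Algebra.smul_def c b
  refine ⟨{ toFun := β, map_add' := fun a b => hj ?_, map_smul' := fun c a => hj ?_ },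
    ⟨fun a b hab => ?_, fun b => ?_⟩, fun a b => hj ?_, fun a => hj ?_⟩
  · rw [map_add, hβ, hβ, hβ, ← map_add]; rfl
  · rw [RingHom.id_apply, hsmul, map_mul, hβ, hβ, ← φ.commutes, ← hΨ, ← map_mul,
      ← IsScalarTower.algebraMap_apply, ← Algebra.smul_def]
    rfl
  · have hab' : β a = β b := hab
    exact Subtype.ext (hΨi (by rw [← hβ, ← hβ, hab']))
  -- Any b is the fraction (X^N b)/(X^N), with numerator and denominator in the image of A.
  · obtain ⟨s, hs⟩ := hN 1
    obtain ⟨a, ha⟩ := hN b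
    have hs0 : s ∈ nonZeroDivisors A := by
      rw [mem_nonZeroDivisors_iff_right]
      intro y hy
      apply hφ
      have h1 := congrArg φ hy
      rw [map_mul, hs, map_zero] at h1
      rw [map_zero]
      funext i
      have h2 := congrFun h1 i
      simpa using h2
    let z : FractionRing A := IsLocalization.mk' _ a ⟨s, hs0⟩
    have hz : Ψ z = j b := by
      refine (IsLocalization.lift_mk'_spec hreg _ _ _).mpr ?_
      change j (φ a) = j (φ s) * j b
      rw [ha, hs, ← map_mul]
      congr 1
      funext i
      simp
    have hzi : IsIntegral A z := by
      obtain ⟨P, hP, hPb⟩ := isIntegralElem_of_forall_exists φ N hN b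
      refine ⟨P, hP, hΨi ?_⟩
      have h1 : Ψ.comp (algebraMap A (FractionRing A)) = j.comp (φ : A →+* (ι → K⟦X⟧)) :=
        RingHom.ext hΨ
      rw [Polynomial.hom_eval₂, h1, hz, ← Polynomial.hom_eval₂, hPb, map_zero, map_zero]
    exact ⟨⟨z, hzi⟩, hj ((hβ _).trans hz)⟩
  · change j (β (a * b)) = j (β a * β b)
    rw [map_mul, hβ, hβ, hβ, ← map_mul]; rfl
  · exact (hβ _).trans (hΨ a)

end Transfer

/-! ### Degree of the conductor of a reduced curve. -/

section ConductorFormula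

variable {K : Type*} [Field K] [IsAlgClosed K] {ι : Type*} [Fintype ι] [DecidableEq ι]
  {p : ι → Series K} (hp : ∀ i, Irreducible (p i)) (hdist : ∀ i j, i ≠ j → ¬ p i ∣ p j)

include hp hdist

theorem exists_normalization_equiv (n : ι → ℕ) (hn : ∀ i, (n i : ℕ∞) = conductorExponent (hp i) +
    ∑ j ∈ Finset.univ.erase i, intersectionNumber (p i) (p j)) :
    ∃ β : Normalization (∏ i, p i) →ₗ[K] (ι → K⟦X⟧), Function.Bijective β ∧
      (∀ a b, β (a * b) = β a * β b) ∧
      ∀ g : Series K, β (algebraMap _ _ (Ideal.Quotient.mk (Ideal.span {∏ i, p i}) g)) =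
        fun i => param (hp i) g := by
  obtain ⟨φ, hφ, hφg⟩ := exists_localRing_hom hp hdist
  obtain ⟨β, hβ, hmul, hβg⟩ := exists_integralClosure_linearMap φ hφ (∑ i, n i) (fun b => by
    obtain ⟨g, hg⟩ := (forall_exists_param_iff hp hdist n hn (fun _ => X ^ ∑ i, n i)).mpr
      (fun i => pow_dvd_pow _ (Finset.single_le_sum (fun _ _ => Nat.zero_le _) (Finset.mem_univ i))) b
    exact ⟨Ideal.Quotient.mk _ g, funext fun i => (hφg g i).trans (hg i)⟩)
  exact ⟨β, hβ, hmul, fun g => (hβg _).trans (funext (hφg g))⟩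

theorem conductorDegree_eq (n : ι → ℕ) (hn : ∀ i, (n i : ℕ∞) = conductorExponent (hp i) +
    ∑ j ∈ Finset.univ.erase i, intersectionNumber (p i) (p j)) :
    conductorDegree (∏ i, p i) = ((∑ i, n i : ℕ) : ℕ∞) := by
  obtain ⟨β, ⟨hβi, hβs⟩, hmul, hβg⟩ := exists_normalization_equiv hp hdist n hn
  have hcond : ∀ a, a ∈ conductor (∏ i, p i) ↔ ∀ i, X ^ n i ∣ β a i := by
    intro a
    rw [← forall_exists_param_iff hp hdist n hn]
    constructor
    · intro h b
      obtain ⟨b, rfl⟩ := hβs b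
      obtain ⟨c, hc⟩ := h b
      obtain ⟨g, rfl⟩ := Ideal.Quotient.mk_surjective c
      refine ⟨g, fun i => ?_⟩
      have := congrArg β hc
      rw [hβg, hmul] at this
      exact congrFun this i
    · intro h b
      obtain ⟨g, hg⟩ := h (β b)
      refine ⟨Ideal.Quotient.mk _ g, hβi ?_⟩
      rw [hβg, hmul]
      exact funext hg
  exact conductorDegree_eq_of_linearMap _ β hβs n hcond

end ConductorFormula

/-! ### Branches, multiplicities and the contact exponent. -/

section Branches

variable {K : Type*} [Field K] [IsAlgClosed K]

instance isDomain_series (K : Type*) [Field K] : IsDomain (Series K) :=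
  NoZeroDivisors.to_isDomain _

theorem exists_irreducible_factorization {f : Series K} (hf : f ≠ 0)
    (hc : MvPowerSeries.constantCoeff f = 0) :
    ∃ (r : ℕ) (p : Fin r → Series K), (∀ i, Irreducible (p i)) ∧ f = ∏ i, p i := by
  have hu : ¬ IsUnit f := fun h => isUnit_iff_constantCoeff_ne_zero.mp h hc
  have : IsNoetherianRing (Series K) := MvPowerSeries.isNoetherianRing K
  obtain ⟨s, hs, hprod, -⟩ := (WfDvdMonoid.not_isUnit_iff_exists_factors_eq f hf).mp hu
  refine ⟨s.toList.length, fun i => s.toList.get i, fun i => ?_, ?_⟩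
  · exact hs _ (Multiset.mem_toList.mp (List.get_mem _ _))
  · rw [← hprod, ← Multiset.prod_toList, ← List.prod_ofFn, List.ofFn_get]

variable {ι : Type*} [Fintype ι] [DecidableEq ι] {p : ι → Series K}

theorem not_dvd_of_squarefree (hp : ∀ i, Irreducible (p i)) (hsq : Squarefree (∏ i, p i)) (i j : ι)
    (hij : i ≠ j) : ¬ p i ∣ p j := by
  intro h
  refine (hp i).not_isUnit (hsq (p i) ?_)
  rw [← Finset.mul_prod_erase _ _ (Finset.mem_univ i)]
  exact mul_dvd_mul_left _ (h.trans (Finset.dvd_prod_of_mem p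
    (Finset.mem_erase.mpr ⟨hij.symm, Finset.mem_univ j⟩)))

theorem numBranches_prod (hp : ∀ i, Irreducible (p i)) (hdist : ∀ i j, i ≠ j → ¬ p i ∣ p j) :
    numBranches (∏ i, p i) = Fintype.card ι := by
  have h : {P : Ideal (Series K) | ∃ q, IsBranchOf q (∏ i, p i) ∧ P = Ideal.span {q}} =
      Set.range fun i => Ideal.span {p i} := by
    ext P
    constructor
    · rintro ⟨q, ⟨hq, hqf⟩, rfl⟩
      obtain ⟨i, -, hi⟩ := ((prime_of_irreducible hq).dvd_finsetProd_iff _).mp hqf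
      exact ⟨i, Ideal.span_singleton_eq_span_singleton.mpr (hq.associated_of_dvd (hp i) hi).symm⟩
    · rintro ⟨i, rfl⟩
      exact ⟨p i, ⟨hp i, Finset.dvd_prod_of_mem p (Finset.mem_univ i)⟩, rfl⟩
  rw [numBranches, h, ← Set.image_univ, Set.ncard_image_of_injective, Set.ncard_univ,
    Nat.card_eq_fintype_card]
  intro i j hij
  by_contra hne
  exact hdist i j hne (Ideal.span_singleton_eq_span_singleton.mp hij).dvd

/-- The multiplicity is the least positive element of the semigroup, attained on a transversal line.
-/
theorem mult_eq_of_semigroup_eq {p q : Series K} (hp : Irreducible p) (hq : Irreducible q)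
    (h : semigroup p = semigroup q) : mult p = mult q := by
  have key : ∀ {p q : Series K}, Irreducible p → Irreducible q → semigroup p = semigroup q →
      mult p ≤ mult q := by
    intro p q hp hq h
    obtain ⟨u, hu, h1⟩ := exists_transversal {q} id (fun i hi => by
      rw [Finset.mem_singleton] at hi; rw [hi]; exact hq.ne_zero)
    have h2 : mult q ∈ semigroup p := by
      rw [h, mem_semigroup_iff hq]
      exact ⟨u, by rw [intersectionNumber_comm]; exact h1 q (Finset.mem_singleton_self q)⟩
    obtain ⟨g, hg⟩ := (mem_semigroup_iff hp).mp h2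
    have hg0 : g ≠ 0 := by
      rintro rfl
      rw [(intersectionNumber_eq_top_iff hp).mpr (dvd_zero p)] at hg
      exact ENat.natCast_ne_top _ hg.symm
    have hgu : ¬ IsUnit g := by
      rw [← intersectionNumber_eq_zero_iff hp, hg]
      exact_mod_cast (mult_pos hq).ne'
    have h3 := mult_mul_mult_le_intersectionNumber hp hg0
    have h4 := one_le_order_of_not_isUnit hgu
    rw [order_eq_mult hg0] at h4
    rw [hg] at h3
    have h5 : mult g * mult p ≤ mult q := by exact_mod_cast h3
    have h6 : 1 ≤ mult g := by exact_mod_cast h4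
    exact (Nat.le_mul_of_pos_left _ h6).trans h5
  exact le_antisymm (key hp hq h) (key hq hp h.symm)

theorem one_le_branchContact {p q : Series K} (hp : Irreducible p) (hq : Irreducible q) :
    1 ≤ branchContact p q := by
  rw [branchContact, ENNReal.le_div_iff_mul_le, one_mul]
  · have h := mult_mul_mult_le_intersectionNumber hp hq.ne_zero
    rw [mul_comm] at h
    have h2 := ENat.toENNReal_mono h
    simpa using h2
  · left
    exact mul_ne_zero (by exact_mod_cast (mult_pos hp).ne') (by exact_mod_cast (mult_pos hq).ne')
  · left
    exact ENNReal.mul_ne_top (ENNReal.natCast_ne_top _) (ENNReal.natCast_ne_top _)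

theorem mult_X (s : Fin 2) : mult (MvPowerSeries.X s : Series K) = 1 := by
  have h := MvPowerSeries.order_monomial_of_ne_zero (R := K) (d := Finsupp.single s 1) one_ne_zero
  rw [mult, MvPowerSeries.X, h, Finsupp.degree_single]; rfl

theorem one_le_contactExponent (f : Series K) : 1 ≤ contactExponent f := by
  refine le_trans ?_ (le_iSup₂_of_le (MvPowerSeries.X 0) ⟨irreducible_X 0, mult_X 0⟩ le_rfl)
  exact le_iInf₂ fun p hp => le_iInf₂ fun q hq => one_le_branchContact hp.1 hq.1

/-- A smooth branch realizing the contact exponent, up to rounding. -/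
theorem exists_smooth_of_contactExponent (hp : ∀ i, Irreducible (p i)) {D : NNReal}
    (hD : contactExponent (∏ i, p i) = D) : ∃ w, IsSmoothBranch w ∧
      ∀ i, ((⌈D * mult (p i)⌉₊ : ℕ) : ℕ∞) ≤ intersectionNumber (p i) w := by
  have hD1 : 1 ≤ D := by
    have := one_le_contactExponent (∏ i, p i)
    rw [hD] at this
    exact_mod_cast this
  have hm : ∀ i, (0 : NNReal) < mult (p i) := fun i => by exact_mod_cast mult_pos (hp i)
  -- The largest fraction with denominator mult (p i) strictly below D. Since intersection numbers
  -- with w are integers, a contact above b i is already at least ⌈D mᵢ⌉ / mᵢ; so attainment of the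
  -- supremum is not needed.
  let b : ι → NNReal := fun i => ((⌈D * mult (p i)⌉₊ - 1 : ℕ) : NNReal) / mult (p i)
  have hk : ∀ i, 0 < ⌈D * mult (p i)⌉₊ := fun i =>
    Nat.ceil_pos.mpr (mul_pos (lt_of_lt_of_le one_pos hD1) (hm i))
  have hb : ∀ i ∈ Finset.univ, b i < D := by
    intro i _
    rw [div_lt_iff₀ (hm i)]
    exact Nat.lt_ceil.mp (Nat.sub_lt (hk i) one_pos)
  have hs : Finset.univ.sup b < D := (Finset.sup_lt_iff (lt_of_lt_of_le one_pos hD1)).mpr hb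
  have hlt : ((Finset.univ.sup b : NNReal) : ℝ≥0∞) < contactExponent (∏ i, p i) := by
    rw [hD]; exact_mod_cast hs
  rw [contactExponent, lt_iSup_iff] at hlt
  obtain ⟨w, hlt⟩ := hlt
  rw [lt_iSup_iff] at hlt
  obtain ⟨hw, hlt⟩ := hlt
  refine ⟨w, hw, fun i => ?_⟩
  have h1 : contact (∏ i, p i) w ≤ branchContact (p i) w :=
    iInf₂_le_of_le (p i) ⟨hp i, Finset.dvd_prod_of_mem p (Finset.mem_univ i)⟩
      (iInf₂_le_of_le w ⟨hw.1, dvd_rfl⟩ le_rfl)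
  have h2 : (b i : ℝ≥0∞) < branchContact (p i) w := by
    refine lt_of_le_of_lt ?_ (hlt.trans_le h1)
    exact_mod_cast Finset.le_sup (f := b) (Finset.mem_univ i)
  by_contra hcon
  rw [not_le] at hcon
  obtain ⟨n, hn⟩ := ENat.ne_top_iff_exists.mp hcon.ne_top
  rw [← hn, Nat.cast_lt] at hcon
  rw [branchContact, hw.2, ← hn] at h2
  have h3 : (b i : ℝ≥0∞) < ((n / mult (p i) : NNReal) : ℝ≥0∞) := by
    refine h2.trans_le (le_of_eq ?_)
    rw [ENNReal.coe_div (hm i).ne']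
    simp
  rw [ENNReal.coe_lt_coe, div_lt_div_iff_of_pos_right (hm i), Nat.cast_lt] at h3
  have := hk i
  omega

/-- The Milnor number equation in terms of real numbers. -/
theorem exists_eq_of_attainsMilnorBound {f : Series K} {c r : ℕ} (h : AttainsMilnorBound f)
    (hc : conductorDegree f = c) (hr : numBranches f = r) (hm : 1 < mult f) :
    ∃ D : NNReal, contactExponent f = D ∧
      (c : ℝ) - r + 1 = ((D : ℝ) * mult f - 1) * (mult f - 1) := by
  rw [AttainsMilnorBound, milnorNumber, hc, hr] at h
  have hL : ((((c : ℕ∞) : ℝ≥0∞) : EReal) - (r : EReal) + 1) = (((c : ℝ) - r + 1 : ℝ) : EReal) := by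
    rw [ENat.toENNReal_coe, EReal.coe_add, EReal.coe_sub]
    rfl
  rw [hL] at h
  have hm1 : ((mult f : EReal) - 1) = (((mult f : ℝ) - 1 : ℝ) : EReal) := by
    push_cast; rfl
  have hpos : (0 : ℝ) < (mult f : ℝ) - 1 := by
    have : (1 : ℝ) < mult f := by exact_mod_cast hm
    linarith
  -- An infinite contact exponent would make the right-hand side infinite, as mult f > 1, while the
  -- left-hand side is real.
  have htop : contactExponent f ≠ ⊤ := by
    intro h1
    rw [h1, hm1, EReal.coe_ennreal_top, EReal.top_mul_of_pos (by exact_mod_cast (by omega : 0 < mult f))]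
      at h
    have h2 : (⊤ : EReal) - 1 = ⊤ := by
      rw [← EReal.coe_one]; exact EReal.top_sub_coe 1
    rw [h2, EReal.top_mul_coe_of_pos hpos] at h
    exact EReal.coe_ne_top _ h
  obtain ⟨D, hD⟩ : ∃ D : NNReal, (D : ℝ≥0∞) = contactExponent f :=
    ⟨_, ENNReal.coe_toNNReal htop⟩
  refine ⟨D, hD.symm, ?_⟩
  rw [← hD] at h
  have h3 : (((D : ℝ≥0∞) : EReal) * (mult f : EReal) - 1) * ((mult f : EReal) - 1) =
      ((((D : ℝ) * mult f - 1) * (mult f - 1) : ℝ) : EReal) := by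
    push_cast
    rfl
  rw [h3] at h
  exact_mod_cast h

end Branches

/-! ### Consequences of equality in the Milnor bound. -/

section Structure

variable {K : Type*} [Field K] [IsAlgClosed K]

/-- The semigroup of the branch `p` is generated by the multiplicity `m` and `D m`, which are
coprime integers unless the branch is smooth. -/
def HasSemigroupOfSlope (D : NNReal) (p : Series K) : Prop :=
  (mult p = 1 ∧ semigroup p = Set.univ) ∨
    (2 ≤ mult p ∧ ∃ b : ℕ, (b : ℝ) = D * mult p ∧ (mult p).Coprime b ∧
      ∀ n, n ∈ semigroup p ↔ ∃ i j : ℕ, n = i * mult p + j * b)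

theorem le_conductorExponent {p u w : Series K} {D : NNReal} (hp : Irreducible p)
    (hu : Irreducible u) (hm : intersectionNumber u p = mult p)
    (hw : intersectionNumber u w = 1)
    (hβ : ((⌈D * mult p⌉₊ : ℕ) : ℕ∞) ≤ intersectionNumber p w) :
    ((mult p : ℝ) - 1) * (D * mult p - 1) ≤ conductorExponent hp := by
  have h := mul_sub_one_lt_conductor_add hp hu (conductorExponent_spec hp) hm (mult_pos hp) hw hβ
  have hle : (D : ℝ) * mult p ≤ (⌈D * mult p⌉₊ : ℕ) := by
    exact_mod_cast Nat.le_ceil (D * mult p)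
  obtain ⟨k, hk⟩ : ∃ k, mult p = k + 1 := ⟨mult p - 1, by have := mult_pos hp; omega⟩
  rw [hk] at h hle ⊢
  have h' : (k : ℝ) * (⌈D * (k + 1 : ℕ)⌉₊ : ℕ) + 1 ≤ conductorExponent hp + (k + 1 : ℕ) := by
    exact_mod_cast h
  push_cast at h' hle ⊢
  nlinarith [mul_le_mul_of_nonneg_left hle (Nat.cast_nonneg (α := ℝ) k)]

/-- For m ≥ 2 the bound c + m > (m-1)β with β = ⌈D m⌉ leaves no room: β = D m and (p,w)₀ = β. Then m
and β are coprime, and c - 1 = mβ - m - β is both a gap of the semigroup and the Frobenius number of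
⟨m, β⟩. -/
theorem hasSemigroupOfSlope {p u w : Series K} {D : NNReal} (hp : Irreducible p)
    (hu : Irreducible u) (hm : intersectionNumber u p = mult p)
    (hw : intersectionNumber u w = 1) (hD : 1 ≤ D)
    (hβ : ((⌈D * mult p⌉₊ : ℕ) : ℕ∞) ≤ intersectionNumber p w)
    (hc : (conductorExponent hp : ℝ) = ((mult p : ℝ) - 1) * (D * mult p - 1)) :
    HasSemigroupOfSlope D p := by
  have hm0 := mult_pos hp
  rcases (show 1 ≤ mult p from hm0).eq_or_lt with h1 | h2
  · left
    refine ⟨h1.symm, Set.eq_univ_of_forall fun n => mem_semigroup_of_le hp ?_⟩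
    rw [← h1, Nat.cast_one, sub_self, zero_mul] at hc
    have : conductorExponent hp = 0 := by exact_mod_cast hc
    omega
  right
  have hcm := mul_sub_one_lt_conductor_add hp hu (conductorExponent_spec hp) hm hm0 hw hβ
  have hle : (D : ℝ) * mult p ≤ (⌈D * mult p⌉₊ : ℕ) := by
    exact_mod_cast Nat.le_ceil (D * mult p)
  set β := ⌈D * mult p⌉₊ with hβdef
  obtain ⟨k, hk⟩ : ∃ k, mult p = k + 1 := ⟨mult p - 1, by omega⟩
  have hk0 : (0 : ℝ) < k := by exact_mod_cast (by omega : 0 < k)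
  have hβeq : (β : ℝ) = D * mult p := by
    refine le_antisymm ?_ hle
    have h' : (k : ℝ) * β + 1 ≤ conductorExponent hp + (k + 1 : ℕ) := by
      rw [hk, Nat.add_sub_cancel] at hcm
      exact_mod_cast hcm
    rw [hc, hk] at h'
    rw [hk]
    push_cast at h' ⊢
    refine le_of_mul_le_mul_left ?_ hk0
    linarith
  have hβ2 : 2 ≤ β := by
    have h3 : (2 : ℝ) ≤ mult p := by exact_mod_cast h2
    have h4 : (1 : ℝ) ≤ D := by exact_mod_cast hD
    have : (2 : ℝ) ≤ β := by rw [hβeq]; nlinarith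
    exact_mod_cast this
  have hceq : conductorExponent hp + mult p = (mult p - 1) * β + 1 := by
    rw [← hβeq] at hc
    rw [hk, Nat.add_sub_cancel]
    rw [hk] at hc
    have : (conductorExponent hp : ℝ) + (k + 1 : ℕ) = k * β + 1 := by
      rw [hc]; push_cast; ring
    exact_mod_cast this
  have hI : intersectionNumber p w = β := by
    refine le_antisymm ?_ hβ
    by_contra hlt
    rw [not_le] at hlt
    have h5 := mul_sub_one_lt_conductor_add hp hu (conductorExponent_spec hp) hm hm0 hw
      (β := β + 1) (by exact_mod_cast Order.add_one_le_of_lt hlt)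
    rw [mul_add] at h5
    omega
  have hcop := coprime_of_conductor_eq hp hu (conductorExponent_spec hp) hm hm0 hw hI (by omega)
    hceq
  refine ⟨h2, β, hβeq, hcop, ?_⟩
  obtain ⟨b, hb⟩ : ∃ b, β = b + 2 := ⟨β - 2, by omega⟩
  have hk1 : 1 ≤ k := by omega
  have hmul : mult p * β = (mult p - 1) * β + β := by
    rw [hk, Nat.add_sub_cancel]; ring
  have hge : 1 ≤ conductorExponent hp := by
    have h7 : β ≤ mult p * β - (mult p - 1) * β := by omega
    rw [hk, Nat.add_sub_cancel, hb] at hceq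
    nlinarith
  refine mem_iff_of_frobenius (zero_mem_semigroup hp)
    (fun x hx y hy => add_mem_semigroup hp hx hy) ?_ ?_ hcop
    (n₀ := conductorExponent hp - 1) (by omega) hm0 (notMem_semigroup_of_succ_eq hp (by omega))
  · exact (mem_semigroup_iff hp).mpr ⟨u, by rw [intersectionNumber_comm]; exact hm⟩
  · exact (mem_semigroup_iff hp).mpr ⟨w, hI⟩

variable {ι : Type*} [Fintype ι] [DecidableEq ι] {p : ι → Series K}

/-- The branches of a reduced curve attaining the bound for the Milnor number, and their mutual
intersection numbers. -/
theorem structure_of_attainsMilnorBound (hp : ∀ i, Irreducible (p i))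
    (hsq : Squarefree (∏ i, p i)) (hsing : IsSingular (∏ i, p i))
    (h : AttainsMilnorBound (∏ i, p i)) :
    ∃ D : NNReal, contactExponent (∏ i, p i) = D ∧ (∀ i, HasSemigroupOfSlope D (p i)) ∧
      ∀ i j, i ≠ j → ∃ k : ℕ, intersectionNumber (p i) (p j) = k ∧
        (k : ℝ) = D * mult (p i) * mult (p j) := by
  have hdist := not_dvd_of_squarefree hp hsq
  have hN : ∀ i j, i ≠ j → ∃ k : ℕ, intersectionNumber (p i) (p j) = k := fun i j hij => by
    obtain ⟨k, hk⟩ := ENat.ne_top_iff_exists.mp fun htop =>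
      hdist i j hij ((intersectionNumber_eq_top_iff (hp i)).mp htop)
    exact ⟨k, hk.symm⟩
  choose! N hN using hN
  let n : ι → ℕ := fun i => conductorExponent (hp i) + ∑ j ∈ Finset.univ.erase i, N i j
  have hcd := conductorDegree_eq hp hdist n fun i => by
    push_cast [n]
    congr 1
    exact Finset.sum_congr rfl fun j hj => (hN i j (Finset.ne_of_mem_erase hj).symm).symm
  obtain ⟨D, hD, heq⟩ := exists_eq_of_attainsMilnorBound h hcd (numBranches_prod hp hdist) hsing
  have hD1 : 1 ≤ D := by
    have := one_le_contactExponent (∏ i, p i)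
    rw [hD] at this
    exact_mod_cast this
  obtain ⟨w, hw, hβ⟩ := exists_smooth_of_contactExponent hp hD
  -- The index `none` carries w, so one line is transversal to w and to all branches.
  obtain ⟨u, hu, hup⟩ := exists_transversal Finset.univ (fun o : Option ι => o.elim w p) (by
    rintro (_ | i) _
    · exact hw.1.ne_zero
    · exact (hp i).ne_zero)
  have huw : intersectionNumber u w = 1 := by
    have := hup none (Finset.mem_univ _)
    rw [Option.elim_none, hw.2] at this
    exact this
  have hum : ∀ i, intersectionNumber u (p i) = mult (p i) := fun i =>
    hup (some i) (Finset.mem_univ _)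
  have hceil : ∀ i, (D : ℝ) * mult (p i) ≤ (⌈D * mult (p i)⌉₊ : ℕ) := fun i => by
    exact_mod_cast Nat.le_ceil (D * mult (p i))
  have hcle : ∀ i, ((mult (p i) : ℝ) - 1) * (D * mult (p i) - 1) ≤ conductorExponent (hp i) :=
    fun i => le_conductorExponent (hp i) hu (hum i) huw (hβ i)
  have hNle : ∀ i, ∀ j ∈ Finset.univ.erase i, (D : ℝ) * mult (p i) * mult (p j) ≤ N i j := by
    intro i j hj
    have hij := (Finset.ne_of_mem_erase hj).symm
    -- Both terms of the minimum, mᵢ⌈D mⱼ⌉ and mⱼ(Cᵢ,w)₀, are at least D mᵢ mⱼ.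
    have h1 := min_le_intersectionNumber (hp i) (hp j) hu
      ((intersectionNumber_comm _ _).trans (hum j)) (mult_pos (hp j)) huw
      (Nat.ceil_pos.mpr (mul_pos (lt_of_lt_of_le one_pos hD1)
        (by exact_mod_cast mult_pos (hp j)))) (hβ j)
      ((intersectionNumber_comm _ _).trans (hum i))
    rw [hN i j hij] at h1
    have h2 := min_le_iff.mp
      (le_trans (min_le_min_left _ (mul_le_mul_right (hβ i) (mult (p j) : ℕ∞))) h1)
    have hi0 : (0 : ℝ) ≤ mult (p i) := Nat.cast_nonneg _
    have hj0 : (0 : ℝ) ≤ mult (p j) := Nat.cast_nonneg _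
    rcases h2 with h3 | h3
    · have h4 : (mult (p i) : ℝ) * (⌈D * mult (p j)⌉₊ : ℕ) ≤ N i j := by exact_mod_cast h3
      nlinarith [mul_le_mul_of_nonneg_left (hceil j) hi0]
    · have h4 : (mult (p j) : ℝ) * (⌈D * mult (p i)⌉₊ : ℕ) ≤ N i j := by exact_mod_cast h3
      nlinarith [mul_le_mul_of_nonneg_left (hceil i) hj0]
  let A : ι → ℝ := fun i => ((mult (p i) : ℝ) - 1) * (D * mult (p i) - 1) +
    ∑ j ∈ Finset.univ.erase i, (D : ℝ) * mult (p i) * mult (p j)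
  have hAn : ∀ i ∈ Finset.univ, A i ≤ n i := fun i _ => by
    push_cast [A, n]
    exact add_le_add (hcle i) (Finset.sum_le_sum (hNle i))
  have hM : (mult (∏ i, p i) : ℝ) = ∑ i, (mult (p i) : ℝ) := by
    rw [mult_prod _ _ fun i _ => (hp i).ne_zero]
    push_cast; rfl
  set M : ℝ := (mult (∏ i, p i) : ℝ) with hMdef
  have hA : ∀ i, A i = D * mult (p i) * M - (D + 1) * mult (p i) + 1 := fun i => by
    have h1 : ∑ j ∈ Finset.univ.erase i, (D : ℝ) * mult (p i) * mult (p j) =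
        D * mult (p i) * (M - mult (p i)) := by
      rw [← Finset.mul_sum, hM, ← Finset.add_sum_erase _ _ (Finset.mem_univ i)]
      ring
    simp only [A, h1]
    ring
  -- The lower bounds sum to DM² - (D+1)M + r, which the hypothesis on the Milnor number equates
  -- with the conductor degree ∑ n i.
  have hsum : ∑ i, A i = ∑ i, (n i : ℝ) := by
    have h1 : ∑ i, A i = D * M * M - (D + 1) * M + Fintype.card ι := by
      rw [Finset.sum_congr rfl fun i _ => hA i, Finset.sum_add_distrib, Finset.sum_sub_distrib,
        ← Finset.sum_mul, ← Finset.mul_sum, ← Finset.mul_sum, ← hM, Finset.sum_const,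
        Finset.card_univ, nsmul_eq_mul, mul_one]
    rw [h1]
    push_cast at heq
    linarith
  have hAeq := (Finset.sum_eq_sum_iff_of_le hAn).mp hsum
  refine ⟨D, hD, fun i => ?_, fun i j hij => ⟨N i j, hN i j hij, ?_⟩⟩
  · refine hasSemigroupOfSlope (hp i) hu (hum i) huw hD1 (hβ i) (le_antisymm ?_ (hcle i))
    have h1 := hAeq i (Finset.mem_univ i)
    push_cast [A, n] at h1
    linarith [Finset.sum_le_sum (hNle i)]
  · have h1 := hAeq i (Finset.mem_univ i)
    push_cast [A, n] at h1
    have h2 : ∑ j ∈ Finset.univ.erase i, (D : ℝ) * mult (p i) * mult (p j) =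
        ∑ j ∈ Finset.univ.erase i, (N i j : ℝ) :=
      le_antisymm (Finset.sum_le_sum (hNle i)) (by linarith [hcle i])
    exact ((Finset.sum_eq_sum_iff_of_le (hNle i)).mp h2 j
      (Finset.mem_erase.mpr ⟨hij.symm, Finset.mem_univ j⟩)).symm

end Structure

/-! ### Arithmetic of the branch multiplicities. -/

section Numerical

/-- The numerical constraints on the multiplicities `m i` of the branches of a curve whose branches
have slope `D`. -/
def IsSlopeFamily {ι : Type*} (D : ℝ) (m : ι → ℕ) : Prop :=
  (∀ i j, i ≠ j → ∃ k : ℕ, (k : ℝ) = D * m i * m j) ∧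
    ∀ i, m i = 1 ∨ (2 ≤ m i ∧ ∃ b : ℕ, (b : ℝ) = D * m i ∧ (m i).Coprime b)

/-- Both m and n are the denominator of D in lowest terms. -/
theorem eq_of_coprime_slope {D : ℝ} {m n b c : ℕ} (hb : (b : ℝ) = D * m)
    (hc : (c : ℝ) = D * n) (hmb : m.Coprime b) (hnc : n.Coprime c) : m = n := by
  have h : b * n = c * m := by
    have : (b : ℝ) * n = c * m := by rw [hb, hc]; ring
    exact_mod_cast this
  apply Nat.dvd_antisymm
  · exact hmb.dvd_of_dvd_mul_left (h ▸ dvd_mul_left m c)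
  · exact hnc.dvd_of_dvd_mul_left (h.symm ▸ dvd_mul_left n b)

variable {ι κ : Type*} [Fintype ι] [Fintype κ]

/-- If all mᵢ are 1 there are at least two of them, and D is their intersection number. Otherwise D
has reduced denominator B ≥ 2, and two smooth branches would make D an integer. -/
theorem IsSlopeFamily.dichotomy {D : ℝ} {m : ι → ℕ} (h : IsSlopeFamily D m) (hM : 2 ≤ ∑ i, m i) :
    ((∃ k : ℕ, (k : ℝ) = D) ∧ ∀ i, m i = 1) ∨
      ∃ B b : ℕ, 2 ≤ B ∧ (b : ℝ) = D * B ∧ B.Coprime b ∧ (∀ i, m i = 1 ∨ m i = B) ∧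
        (Finset.univ.filter fun i => m i = 1).card ≤ 1 := by
  classical
  by_cases hall : ∀ i, m i = 1
  · left
    refine ⟨?_, hall⟩
    simp only [hall, Finset.sum_const, smul_eq_mul, mul_one] at hM
    obtain ⟨i, -, j, -, hij⟩ := Finset.one_lt_card.mp hM
    obtain ⟨k, hk⟩ := h.1 i j hij
    exact ⟨k, by rw [hk, hall i, hall j]; simp⟩
  right
  obtain ⟨i, hi⟩ := not_forall.mp hall
  obtain ⟨hi2, b, hb, hcop⟩ := (h.2 i).resolve_left hi
  refine ⟨m i, b, hi2, hb, hcop, fun j => ?_, ?_⟩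
  · refine (h.2 j).imp_right fun ⟨hj2, c, hc, hcop'⟩ => ?_
    exact eq_of_coprime_slope hc hb hcop' hcop
  · by_contra hcard
    obtain ⟨j, hj, l, hl, hjl⟩ := Finset.one_lt_card.mp (not_le.mp hcard)
    obtain ⟨k, hk⟩ := h.1 j l hjl
    rw [(Finset.mem_filter.mp hj).2, (Finset.mem_filter.mp hl).2, Nat.cast_one, mul_one,
      mul_one] at hk
    exact hi (eq_of_coprime_slope (n := 1) hb (c := k) (by simpa using hk) hcop
      (Nat.coprime_one_left k))

theorem sum_eq_card_add_mul_card {m : ι → ℕ} {B : ℕ} (hB : 2 ≤ B) (h : ∀ i, m i = 1 ∨ m i = B) :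
    ∑ i, m i = (Finset.univ.filter fun i => m i = 1).card +
      B * (Finset.univ.filter fun i => m i = B).card := by
  rw [Finset.card_filter, Finset.card_filter, Finset.mul_sum, ← Finset.sum_add_distrib]
  refine Finset.sum_congr rfl fun i _ => ?_
  rcases h i with h | h <;> rw [h]
  · rw [if_pos rfl, if_neg (by omega), mul_zero, add_zero]
  · rw [if_pos rfl, if_neg (by omega), mul_one, zero_add]

/-- The multiplicities of the branches are determined by the slope and by their sum. -/
theorem IsSlopeFamily.exists_equiv {D : ℝ} {m : ι → ℕ} {n : κ → ℕ} (hm : IsSlopeFamily D m)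
    (hn : IsSlopeFamily D n) (hsum : ∑ i, m i = ∑ i, n i) (h2 : 2 ≤ ∑ i, m i) :
    ∃ σ : ι ≃ κ, ∀ i, n (σ i) = m i := by
  classical
  suffices hcard : ∀ d, (Finset.univ.filter fun i => m i = d).card =
      (Finset.univ.filter fun i => n i = d).card by
    let e : ∀ d, {i // m i = d} ≃ {i // n i = d} := fun d =>
      Fintype.equivOfCardEq (by rw [Fintype.card_subtype, Fintype.card_subtype, hcard d])
    exact ⟨Equiv.ofFiberEquiv e, fun i => Equiv.ofFiberEquiv_map e i⟩
  intro d
  have hcontra : ∀ k B b : ℕ, (k : ℝ) = D → 2 ≤ B → (b : ℝ) = D * B → B.Coprime b → False :=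
    fun k B b hk hB hb hcop => by
      have := eq_of_coprime_slope (n := 1) hb (c := k) (by simpa using hk) hcop
        (Nat.coprime_one_left k)
      omega
  rcases hm.dichotomy h2 with ⟨⟨k, hk⟩, h1⟩ | ⟨B, b, hB, hb, hcop, h1, hc1⟩ <;>
    rcases hn.dichotomy (hsum ▸ h2) with ⟨⟨k', hk'⟩, h1'⟩ | ⟨B', b', hB', hb', hcop', h1', hc1'⟩
  · simp only [h1, h1', Finset.sum_const, smul_eq_mul, mul_one] at hsum ⊢
    by_cases hd : 1 = d
    · simpa [hd] using hsum
    · simp [hd]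
  · exact (hcontra k B' b' hk hB' hb' hcop').elim
  · exact (hcontra k' B b hk' hB hb hcop).elim
  · obtain rfl := eq_of_coprime_slope hb hb' hcop hcop'
    rw [sum_eq_card_add_mul_card hB h1, sum_eq_card_add_mul_card hB h1'] at hsum
    set x := (Finset.univ.filter fun i => m i = 1).card with hx
    set x' := (Finset.univ.filter fun i => n i = 1).card with hx'
    set y := (Finset.univ.filter fun i => m i = B).card with hy
    set y' := (Finset.univ.filter fun i => n i = B).card with hy'
    -- Both sums are x + B y with x ≤ 1 < B, so x is the residue modulo B.
    have hxx : x = x' := by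
      have := congrArg (· % B) hsum
      simp only [Nat.add_mul_mod_self_left] at this
      rwa [Nat.mod_eq_of_lt (by omega), Nat.mod_eq_of_lt (by omega)] at this
    have hyy : y = y' := by
      rw [hxx] at hsum
      exact Nat.eq_of_mul_eq_mul_left (by omega) (Nat.add_left_cancel hsum)
    by_cases hd1 : d = 1
    · rw [hd1]; exact hxx
    by_cases hdB : d = B
    · rw [hdB]; exact hyy
    rw [Finset.filter_eq_empty_iff.mpr fun i _ hi => (h1 i).elim (by omega) (by omega),
      Finset.filter_eq_empty_iff.mpr fun i _ hi => (h1' i).elim (by omega) (by omega)]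
    rw [Finset.card_empty, Finset.card_empty]

end Numerical

/-! ### The two implications of the theorem. -/

section Equisingularity

variable {K : Type*} [Field K] [IsAlgClosed K]

theorem HasSemigroupOfSlope.semigroup_eq {D : NNReal} {p q : Series K}
    (hp : HasSemigroupOfSlope D p) (hq : HasSemigroupOfSlope D q) (h : mult p = mult q) :
    semigroup p = semigroup q := by
  rcases hp with ⟨h1, hp⟩ | ⟨h1, b, hb, -, hp⟩ <;> rcases hq with ⟨h2, hq⟩ | ⟨h2, c, hc, -, hq⟩
  · rw [hp, hq]
  · omega
  · omega
  · have hbc : b = c := by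
      have : (b : ℝ) = c := by rw [hb, hc, h]
      exact_mod_cast this
    ext n
    rw [hp, hq, hbc, h]

/-- The generator b = D m lies in ⟨m, c⟩ with c = E m. Being prime to m ≥ 2 it is no multiple of m,
so its expression involves c, whence c ≤ b. -/
theorem le_of_semigroup_eq {D E : NNReal} {p q : Series K} (hp : HasSemigroupOfSlope D p)
    (hq : HasSemigroupOfSlope E q) (hm : 2 ≤ mult p) (h : mult p = mult q)
    (hs : semigroup p = semigroup q) : E ≤ D := by
  obtain ⟨-, b, hb, hcop, hp⟩ := hp.resolve_left fun h1 => by omega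
  obtain ⟨-, c, hc, -, hq⟩ := hq.resolve_left fun h1 => by omega
  have hbq : b ∈ semigroup q := hs ▸ (hp b).mpr ⟨0, 1, by ring⟩
  obtain ⟨i, j, hij⟩ := (hq b).mp hbq
  have hj : j ≠ 0 := by
    rintro rfl
    have hd : mult p ∣ b := ⟨i, by rw [hij, h]; ring⟩
    have := Nat.Coprime.eq_one_of_dvd hcop hd
    omega
  have hcb : c ≤ b := by
    rw [hij]
    exact (Nat.le_mul_of_pos_left c (Nat.pos_of_ne_zero hj)).trans (Nat.le_add_left _ _)
  have hcb' : (c : ℝ) ≤ b := by exact_mod_cast hcb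
  rw [hb, hc, h] at hcb'
  have hm0 : (0 : ℝ) < mult q := by exact_mod_cast (by omega : 0 < mult q)
  exact_mod_cast le_of_mul_le_mul_right hcb' hm0

theorem mult_and_contactExponent_eq_of_equisingular {f g : Series K} (hf : IsReducedCurve f)
    (hg : IsReducedCurve g) (hfs : IsSingular f) (hgs : IsSingular g) (hfm : AttainsMilnorBound f)
    (hgm : AttainsMilnorBound g) (h : Equisingular f g) :
    mult f = mult g ∧ contactExponent f = contactExponent g := by
  obtain ⟨r, p, q, hp, hq, rfl, rfl, hs, hI⟩ := h
  have hm : ∀ i, mult (p i) = mult (q i) := fun i => mult_eq_of_semigroup_eq (hp i) (hq i) (hs i)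
  have hmp := mult_prod Finset.univ p fun i _ => (hp i).ne_zero
  have hmq := mult_prod Finset.univ q fun i _ => (hq i).ne_zero
  refine ⟨by rw [hmp, hmq, Finset.sum_congr rfl fun i _ => hm i], ?_⟩
  obtain ⟨D, hD, hDs, hDI⟩ := structure_of_attainsMilnorBound hp hf.2.2 hfs hfm
  obtain ⟨E, hE, hEs, hEI⟩ := structure_of_attainsMilnorBound hq hg.2.2 hgs hgm
  rw [hD, hE, ENNReal.coe_inj]
  rw [IsSingular, hmp] at hfs
  -- A single branch is singular, so D is read off its semigroup; with two branches, D is (C₀,C₁)₀ /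
  -- (m₀ m₁).
  rcases le_or_gt r 1 with hr | hr
  · have hr1 : r = 1 := by
      refine le_antisymm hr (Nat.pos_of_ne_zero ?_)
      rintro rfl
      simp at hfs
    subst hr1
    rw [Fin.sum_univ_one] at hfs
    exact le_antisymm (le_of_semigroup_eq (hEs 0) (hDs 0) (by rw [← hm]; exact hfs) (hm 0).symm
      (hs 0).symm) (le_of_semigroup_eq (hDs 0) (hEs 0) hfs (hm 0) (hs 0))
  · have hne : (⟨0, by omega⟩ : Fin r) ≠ ⟨1, hr⟩ := by simp
    obtain ⟨k, hk, hkD⟩ := hDI _ _ hne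
    obtain ⟨l, hl, hlE⟩ := hEI _ _ hne
    rw [hI, hl, Nat.cast_inj] at hk
    rw [hm, hm, ← hk, hlE] at hkD
    have h0 : (mult (q ⟨0, by omega⟩) : ℝ) * mult (q ⟨1, hr⟩) ≠ 0 := by
      exact_mod_cast (Nat.mul_pos (mult_pos (hq _)) (mult_pos (hq _))).ne'
    rw [mul_assoc, mul_assoc] at hkD
    exact_mod_cast (mul_right_cancel₀ h0 hkD).symm

theorem equisingular_of_mult_eq_of_contactExponent_eq {f g : Series K} (hf : IsReducedCurve f)
    (hg : IsReducedCurve g) (hfs : IsSingular f) (hgs : IsSingular g) (hfm : AttainsMilnorBound f)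
    (hgm : AttainsMilnorBound g) (hmult : mult f = mult g)
    (hcontact : contactExponent f = contactExponent g) : Equisingular f g := by
  obtain ⟨r, p, hp, rfl⟩ := exists_irreducible_factorization hf.1 hf.2.1
  obtain ⟨s, q, hq, rfl⟩ := exists_irreducible_factorization hg.1 hg.2.1
  obtain ⟨D, hD, hDs, hDI⟩ := structure_of_attainsMilnorBound hp hf.2.2 hfs hfm
  obtain ⟨E, hE, hEs, hEI⟩ := structure_of_attainsMilnorBound hq hg.2.2 hgs hgm
  obtain rfl : D = E := by rwa [hD, hE, ENNReal.coe_inj] at hcontact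
  have hmp := mult_prod Finset.univ p fun i _ => (hp i).ne_zero
  have hmq := mult_prod Finset.univ q fun i _ => (hq i).ne_zero
  have hslope : ∀ {t : ℕ} {p : Fin t → Series K}, (∀ i, HasSemigroupOfSlope D (p i)) →
      (∀ i j, i ≠ j → ∃ k : ℕ, intersectionNumber (p i) (p j) = k ∧
        (k : ℝ) = D * mult (p i) * mult (p j)) → IsSlopeFamily (D : ℝ) fun i => mult (p i) :=
    fun hs hI => ⟨fun i j hij => (hI i j hij).imp fun _ h => h.2, fun i => (hs i).imp (·.1)
      fun ⟨h2, b, hb, hcop, _⟩ => ⟨h2, b, hb, hcop⟩⟩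
  obtain ⟨σ, hσ⟩ := (hslope hDs hDI).exists_equiv (hslope hEs hEI) (by rw [← hmp, ← hmq, hmult])
    (by rw [← hmp]; exact hfs)
  refine ⟨r, p, fun i => q (σ i), hp, fun i => hq _, rfl, (Equiv.prod_comp σ q).symm,
    fun i => (hDs i).semigroup_eq (hEs _) (hσ i).symm, fun i j => ?_⟩
  by_cases hij : i = j
  · rw [hij, (intersectionNumber_eq_top_iff (hp j)).mpr dvd_rfl,
      (intersectionNumber_eq_top_iff (hq _)).mpr dvd_rfl]
  · obtain ⟨k, hk, hkD⟩ := hDI i j hij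
    obtain ⟨l, hl, hlE⟩ := hEI (σ i) (σ j) (σ.injective.ne hij)
    have hkl : k = l := by
      have : (k : ℝ) = l := by rw [hkD, hlE, ← hσ i, ← hσ j]
      exact_mod_cast this
    rw [hk, hl, hkl]

end Equisingularity

end PlaneCurve

end

theorem mainTheorem7 {K : Type*} [Field K] [IsAlgClosed K]
    (f₁ f₂ : PlaneCurve.Series K)
    (hred₁ : PlaneCurve.IsReducedCurve f₁) (hred₂ : PlaneCurve.IsReducedCurve f₂)
    (hsing₁ : PlaneCurve.IsSingular f₁) (hsing₂ : PlaneCurve.IsSingular f₂)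
    (hμ₁ : PlaneCurve.AttainsMilnorBound f₁) (hμ₂ : PlaneCurve.AttainsMilnorBound f₂) :
    PlaneCurve.Equisingular f₁ f₂ ↔
      (PlaneCurve.mult f₁, PlaneCurve.contactExponent f₁) =
        (PlaneCurve.mult f₂, PlaneCurve.contactExponent f₂) := by
  rw [Prod.mk.injEq]
  exact ⟨PlaneCurve.mult_and_contactExponent_eq_of_equisingular hred₁ hred₂ hsing₁ hsing₂ hμ₁ hμ₂,
    fun h => PlaneCurve.equisingular_of_mult_eq_of_contactExponent_eq hred₁ hred₂ hsing₁ hsing₂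
      hμ₁ hμ₂ h.1 h.2⟩
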